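/- There is an absolute constant $C>0$ with the following property. Let $K\ge d$ be natural numbers, and let $F$ be a probability distribution on $\mathbb{R}^d$ satisfying: (1) $F=qI+\sum_{m=1}^K p_mF_m$, where $I$ is the unit mass at the origin, $F_1,\dots,F_K$ are probability distributions on $\mathbb{R}^d$, $q,p_1,\dots,p_K\in(0,1)$ and $\sum_{m=1}^K p_m=1-q$; (2) there are non-zero vectors $y_1,\dots,y_K\in\mathbb{R}^d$ such that $\operatorname{supp}F_m\subset\{ky_m: k\in\mathbb{Z}\setminus\{0\}\}$ for all $m$, and $\operatorname{supp}F_m\cap\operatorname{supp}F_k=\emptyset$ for $k\neq m$; (3) each $\operatorname{supp}F_m$ is non-empty and $F_m\{ky_m\}=F_m\{-ky_m\}$ for $k=1,2,\dots$ and all $m$; (4) for every $m$ there is an integer $k_m^0$ with $F_m\{k_m^0y_m\}>0$ and $F_m\{(k_m^0+1)y_m\}>0$. Let $\sigma_m=\bigl(\sum_{k\in\mathbb{Z}}k^2F_m\{ky_m\}\bigr)^{1/2}\in[0,\infty]$. Products and powers of finite signed measures on $\mathbb{R}^d$ marked by $*$ are convolutions, with $M^{*0}=I$; $\exp\{M\}=\sum_{j\ge0}M^{*j}/j!$;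 and $\delta(M,N)=\sup_B|M\{B\}-N\{B\}|$, the supremum over all Borel sets $B\subset\mathbb{R}^d$, is the total variation distance. Then for every $n\in\{1,2,\dots\}$ $$\delta\Bigl(F^{*n},\ \exp\{n(F-I)\}*\bigl(I-\tfrac n2(F-I)^{*2}\bigr)\Bigr)\le\frac{C}{n^2q^{13/2}}\Bigl(\sum_{m=1}^K\sqrt{1+\sigma_m}\Bigr)^4 ,$$ where the right-hand side is $+\infty$ (and the bound is trivial) if some $\sigma_m=\infty$. -/

import Mathlib

open MeasureTheory
open scoped ENNReal

namespace SymCP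

section SignedMeasures

variable {E : Type*} [AddCommGroup E] [MeasurableSpace E]

/-- A (finite, real) signed measure has finite total variation. -/
theorem isFiniteMeasure_variation {X : Type*} [MeasurableSpace X] (M : SignedMeasure X) :
    IsFiniteMeasure M.variation := by
  rw [← SignedMeasure.totalVariation_eq_variation]
  infer_instance

/-- The distribution `I` concentrated at the origin, as a signed measure. -/
noncomputable def unitMass (E : Type*) [AddCommGroup E] [MeasurableSpace E] : SignedMeasure E :=
  VectorMeasure.dirac 0 1

/-- Convolution `M * V` of signed measures: the image of the product measure `M × V`
under addition. -/
noncomputable def conv (M V : SignedMeasure E) : SignedMeasure E :=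
  (M.prod V (ContinuousLinearMap.mul ℝ ℝ)).map (fun z : E × E => z.1 + z.2)

/-- Convolution powers `M^{*j}`, with `M^{*0} = I`. -/
noncomputable def convPow (M : SignedMeasure E) : ℕ → SignedMeasure E
  | 0 => unitMass E
  | j + 1 => conv (convPow M j) M

/-- `‖M * V‖ ≤ ‖M‖ ‖V‖` for the total variation norm. -/
theorem variation_conv_univ_le (M V : SignedMeasure E) :
    (conv M V).variation Set.univ ≤ M.variation Set.univ * V.variation Set.univ := by
  have := isFiniteMeasure_variation M
  have := isFiniteMeasure_variation V
  calc (conv M V).variation Set.univ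
      ≤ ((M.prod V (ContinuousLinearMap.mul ℝ ℝ)).variation.map
          (fun z : E × E => z.1 + z.2)) Set.univ := VectorMeasure.variation_map_le _
    _ ≤ (M.prod V (ContinuousLinearMap.mul ℝ ℝ)).variation Set.univ := by
        by_cases h : AEMeasurable (fun z : E × E => z.1 + z.2)
            (M.prod V (ContinuousLinearMap.mul ℝ ℝ)).variation
        · rw [Measure.map_apply_of_aemeasurable h MeasurableSet.univ, Set.preimage_univ]
        · rw [Measure.map_of_not_aemeasurable h]; simp
    _ ≤ (‖ContinuousLinearMap.mul ℝ ℝ‖ₑ • M.variation.prod V.variation) Set.univ :=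
        VectorMeasure.variation_prod_le _
    _ = M.variation Set.univ * V.variation Set.univ := by
        have h1 : ‖ContinuousLinearMap.mul ℝ ℝ‖ₑ = 1 := by
          rw [← ofReal_norm, ContinuousLinearMap.opNorm_mul]; simp
        rw [h1, one_smul, ← Set.univ_prod_univ, Measure.prod_prod]

/-- `|M^{*j}{A}| ≤ ‖M‖^j`. -/
theorem norm_convPow_apply_le (M : SignedMeasure E) (j : ℕ) (A : Set E) :
    ‖convPow M j A‖ ≤ (M.variation Set.univ).toReal ^ j := by
  have := isFiniteMeasure_variation M
  have key : (convPow M j).variation Set.univ ≤ M.variation Set.univ ^ j := by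
    induction j with
    | zero => simp [convPow, unitMass]
    | succ j ih =>
      rw [convPow, pow_succ]
      exact (variation_conv_univ_le _ _).trans (mul_le_mul_left ih _)
  have h : ‖convPow M j A‖ₑ ≤ M.variation Set.univ ^ j :=
    ((VectorMeasure.enorm_measure_le_variation _ A).trans (measure_mono (Set.subset_univ A))).trans
      key
  rw [← ENNReal.toReal_pow, ← toReal_enorm]
  exact ENNReal.toReal_mono (ENNReal.pow_ne_top (measure_ne_top _ _)) h

/-- The exponential measure `exp{M} = ∑_{j ≥ 0} M^{*j} / j!`. The series converges absolutely,
uniformly over all sets, because `|M^{*j}{A}| ≤ ‖M‖^j`. -/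
noncomputable def expMeasure (M : SignedMeasure E) : SignedMeasure E where
  measureOf' A := ∑' j : ℕ, ((j.factorial : ℝ))⁻¹ * convPow M j A
  empty' := by simp
  not_measurable' A hA := by simp [VectorMeasure.not_measurable _ hA]
  m_iUnion' f hf hd := by
    set T : ℝ := (M.variation Set.univ).toReal with hT
    have hsum : Summable (fun j : ℕ => ((j.factorial : ℝ))⁻¹ * T ^ j) := by
      simpa [div_eq_inv_mul] using Real.summable_pow_div_factorial T
    have hbound : ∀ (A : Set E) (j : ℕ),
        ‖((j.factorial : ℝ))⁻¹ * convPow M j A‖ ≤ ((j.factorial : ℝ))⁻¹ * T ^ j := by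
      intro A j
      rw [norm_mul, Real.norm_of_nonneg (by positivity)]
      exact mul_le_mul_of_nonneg_left (norm_convPow_apply_le M j A) (by positivity)
    have hs : ∀ A : Set E, Summable (fun j : ℕ => ((j.factorial : ℝ))⁻¹ * convPow M j A) :=
      fun A => Summable.of_norm_bounded hsum (hbound A)
    have hfin : ∀ (a : Finset ℕ) (j : ℕ),
        ∑ i ∈ a, ((j.factorial : ℝ))⁻¹ * convPow M j (f i)
          = ((j.factorial : ℝ))⁻¹ * convPow M j (⋃ i ∈ a, f i) := by
      intro a j
      rw [← Finset.mul_sum, VectorMeasure.of_biUnion_finset]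
      · exact fun i _ k _ hik => hd hik
      · exact fun i _ => hf i
    have hlim : Filter.Tendsto
        (fun a : Finset ℕ => ∑' j : ℕ, ∑ i ∈ a, ((j.factorial : ℝ))⁻¹ * convPow M j (f i))
        Filter.atTop (nhds (∑' j : ℕ, ((j.factorial : ℝ))⁻¹ * convPow M j (⋃ i, f i))) := by
      refine tendsto_tsum_of_dominated_convergence hsum ?_ ?_
      · intro j
        exact ((convPow M j).m_iUnion hf hd).mul_left _
      · refine Filter.Eventually.of_forall fun a j => ?_
        rw [hfin]
        exact hbound _ j
    simp only [HasSum, SummationFilter.unconditional_filter]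
    refine hlim.congr fun a => ?_
    rw [Summable.tsum_finsetSum fun i _ => hs (f i)]

/-- The total variation distance `sup_B |M{B} - N{B}|` over measurable sets `B`. -/
noncomputable def tvDist (M N : SignedMeasure E) : ℝ≥0∞ :=
  ⨆ (B : Set E) (_ : MeasurableSet B), ENNReal.ofReal |M B - N B|

end SignedMeasures

section Lines

variable {d K : ℕ}

/-- The distribution `F` on `ℝ^d` is a mixture `q I + ∑ p_m F_m` of the unit mass at the origin and
`K ≥ d` symmetric distributions `F_m`, where `F_m` lives on the nonzero integer multiples of a
nonzero vector `y_m`, the supports are pairwise disjoint, and `F_m` charges two consecutive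
multiples of `y_m`. -/
structure IsLineMixture (F : Measure (EuclideanSpace ℝ (Fin d))) (q : ℝ) (p : Fin K → ℝ)
    (Fm : Fin K → Measure (EuclideanSpace ℝ (Fin d)))
    (y : Fin K → EuclideanSpace ℝ (Fin d)) : Prop where
  le_card : d ≤ K
  isProb : ∀ m, IsProbabilityMeasure (Fm m)
  q_mem : q ∈ Set.Ioo (0 : ℝ) 1
  p_mem : ∀ m, p m ∈ Set.Ioo (0 : ℝ) 1
  sum_p : ∑ m, p m = 1 - q
  eq_mixture : F = ENNReal.ofReal q • Measure.dirac 0 + ∑ m, ENNReal.ofReal (p m) • Fm m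
  y_ne_zero : ∀ m, y m ≠ 0
  support_subset : ∀ m, (Fm m).support ⊆ {x | ∃ k : ℤ, k ≠ 0 ∧ x = k • y m}
  support_disjoint : ∀ m k, k ≠ m → (Fm m).support ∩ (Fm k).support = ∅
  support_nonempty : ∀ m, (Fm m).support ≠ ∅
  symm : ∀ m, ∀ k : ℕ, 1 ≤ k → Fm m {(k : ℤ) • y m} = Fm m {(-(k : ℤ)) • y m}
  lattice : ∀ m, ∃ k : ℤ, 0 < Fm m {k • y m} ∧ 0 < Fm m {(k + 1) • y m}

/-- `σ = (∑_{k ∈ ℤ} k² G{k y})^{1/2}`, the standard deviation of the integer variable `Y` with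
`P(Y = k) = G{k y}` for a symmetric distribution `G` on the integer multiples of `y`;
it may be infinite. -/
noncomputable def lineSigma (G : Measure (EuclideanSpace ℝ (Fin d)))
    (y : EuclideanSpace ℝ (Fin d)) : ℝ≥0∞ :=
  (∑' k : ℤ, ENNReal.ofReal ((k : ℝ) ^ 2) * G {k • y}) ^ (1 / 2 : ℝ)

end Lines

end SymCP

/-! All the measures involved are countable combinations of point masses, so the question moves to a
commutative Banach algebra: the closed algebra generated by translations acting on bounded
functions. If `M = ∑ a_i δ_{v_i}` corresponds to `T = ∑ a_i shift v_i`, then `M B = (T 1_B)(0)`, so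
the operator norm dominates total variation distance (`exists_algebra_tvDist_le`), while convolution
becomes multiplication.

Let `x = q + ∑ p_m T_m` be the image of `F`, and let `Δ = x - 1` and `S = ∑ √(1 + σ_m)`. Everything
rests on the smoothing estimate `‖Δ x^N‖ ≤ D / (N + 1)` with `D = 162 S / q^{3/2}`. Poisson
averaging gives the same kind of decay for `Δ exp(aΔ)`. With `y = exp Δ`, expanding `x^n` around `y`
to second order leaves about `n²` terms of order `Δ⁴` and `n` terms of order `Δ³`. Sharing the
powers of `x` or `y` equally among the factors `Δ` makes each factor `O(D/n)`, so the total is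
`O(D⁴/n²)` (`norm_pow_sub_exp_mul_le`). Since `D⁴` is a constant times `S⁴ q^{-6}` and `q < 1`, the
exponent `13/2` follows.

The smoothing estimate is first proved on one line, for `(T_m - 1) Q_m^N` with `Q_m = q + (1 - q)
T_m`. Its norm is at most the `ℓ¹` norm of a sequence on `ℤ`. This is controlled by the `ℓ²` norms
of the sequence and of `k` times the sequence, that is, by Parseval, by integrals of a function on
the circle and of its derivative. Both are dominated by the integral of `exp(-a (1 - φ))`, with `φ`
the characteristic function of the law and `a = min(q, 1 - q) N`, which is at most `1/√a` because
the law has no mass at `0`. The lines are then combined by writing `x` as a convex combination of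
the `Q_m` and averaging binomially (`norm_mul_add_pow_le`); the weights `p_m` cancel, so no lower
bound on them is needed. -/

namespace SymCP

/-! ### Absolutely summable sequences on `ℤ` and their symbols -/

section Wiener

/-- The change of variables `(k, j) ↦ (j, k - j)`. -/
def zPairEquiv : ℤ × ℤ ≃ ℤ × ℤ where
  toFun p := (p.2, p.1 - p.2)
  invFun p := (p.1 + p.2, p.1)
  left_inv p := by ext <;> simp
  right_inv p := by ext <;> simp

/-- Multiply the two absolutely convergent series and group the terms by total index. Used both in
the target algebra and in the continuous functions on the circle. -/
theorem hasSum_zconv {A : Type*} [NormedCommRing A] [NormedAlgebra ℝ A] [CompleteSpace A]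
    {u : ℤ → A} (hu : ∀ k, ‖u k‖ ≤ 1) (hadd : ∀ i j, u (i + j) = u i * u j)
    {a b : ℤ → ℝ} (ha : Summable fun k => ‖a k‖) (hb : Summable fun k => ‖b k‖) {x y : A}
    (hx : HasSum (fun k => a k • u k) x) (hy : HasSum (fun k => b k • u k) y) :
    HasSum (fun k => (∑' j, a j * b (k - j)) • u k) (x * y) := by
  have hna : ∀ {a : ℤ → ℝ}, (Summable fun k => ‖a k‖) → Summable fun k => ‖a k • u k‖ := by
    intro a ha
    refine Summable.of_nonneg_of_le (fun _ => norm_nonneg _) (fun k => ?_) ha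
    rw [norm_smul]
    exact mul_le_of_le_one_right (norm_nonneg _) (hu k)
  have hs : Summable fun p : ℤ × ℤ => (a p.1 • u p.1) * (b p.2 • u p.2) :=
    summable_mul_of_summable_norm (f := fun k => a k • u k) (g := fun k => b k • u k)
      (hna ha) (hna hb)
  have h1 : HasSum (fun p : ℤ × ℤ => (a p.1 • u p.1) * (b p.2 • u p.2)) (x * y) := by
    have := hs.hasSum
    rwa [← tsum_mul_tsum_of_summable_norm (hna ha) (hna hb), hx.tsum_eq, hy.tsum_eq] at this
  have h2 : HasSum (fun p : ℤ × ℤ => (a p.2 * b (p.1 - p.2)) • u p.1) (x * y) := by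
    rw [← zPairEquiv.hasSum_iff] at h1
    have heq : ∀ p : ℤ × ℤ, (a (zPairEquiv p).1 • u (zPairEquiv p).1) *
        (b (zPairEquiv p).2 • u (zPairEquiv p).2) = (a p.2 * b (p.1 - p.2)) • u p.1 := by
      intro p
      simp only [zPairEquiv, Equiv.coe_fn_mk]
      rw [smul_mul_smul_comm, ← hadd, add_sub_cancel]
    simpa only [Function.comp_def, heq] using h1
  have hab : Summable fun p : ℤ × ℤ => a p.2 * b (p.1 - p.2) :=
    (zPairEquiv.summable_iff (f := fun p : ℤ × ℤ => a p.1 * b p.2)).2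
      (summable_mul_of_summable_norm ha hb)
  exact h2.prod_fiberwise fun k => (hab.prod_factor k).hasSum.smul_const (u k)

theorem summable_norm_zconv {a b : ℤ → ℝ} (ha : Summable fun k => ‖a k‖)
    (hb : Summable fun k => ‖b k‖) : Summable fun k => ‖∑' j, a j * b (k - j)‖ := by
  have h := hasSum_zconv (A := ℝ) (u := fun _ => 1) (by simp) (by simp)
    (a := fun k => ‖a k‖) (b := fun k => ‖b k‖) (by simpa using ha) (by simpa using hb)
    (by simpa using ha.hasSum) (by simpa using hb.hasSum)
  refine Summable.of_nonneg_of_le (fun _ => norm_nonneg _) (fun k => ?_) h.summable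
  simp only [smul_eq_mul, mul_one]
  have hb' : ∃ B, ∀ k, ‖b k‖ ≤ B := ⟨∑' k, ‖b k‖, fun k => hb.le_tsum k fun _ _ => norm_nonneg _⟩
  obtain ⟨B, hB⟩ := hb'
  have hs : Summable fun j => ‖a j * b (k - j)‖ :=
    Summable.of_nonneg_of_le (fun _ => norm_nonneg _) (fun j => by
      rw [norm_mul]; exact mul_le_mul_of_nonneg_left (hB _) (norm_nonneg _)) (ha.mul_right B)
  refine (norm_tsum_le_tsum_norm hs).trans_eq ?_
  simp only [norm_mul]

/-- Splitting `k = j + (k - j)` makes multiplication by `k` a derivation for convolution; this is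
how the derivative of a symbol is tracked without differentiating. -/
theorem mul_zconv {a b : ℤ → ℝ} (ha : Summable fun k => ‖a k‖) (hb : Summable fun k => ‖b k‖)
    (ha' : Summable fun k : ℤ => ‖(k : ℝ) * a k‖) (hb' : Summable fun k : ℤ => ‖(k : ℝ) * b k‖)
    (k : ℤ) : (k : ℝ) * ∑' j : ℤ, a j * b (k - j) =
      ∑' j : ℤ, ((j : ℝ) * a j) * b (k - j) +
        ∑' j : ℤ, a j * (((k - j : ℤ) : ℝ) * b (k - j)) := by
  have key : ∀ {a b : ℤ → ℝ}, (Summable fun k => ‖a k‖) → (Summable fun k => ‖b k‖) →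
      Summable fun j : ℤ => a j * b (k - j) := by
    intro a b ha hb
    refine Summable.of_norm_bounded (ha.mul_right (∑' k, ‖b k‖)) fun j => ?_
    rw [norm_mul]
    exact mul_le_mul_of_nonneg_left (hb.le_tsum _ fun _ _ => norm_nonneg _) (norm_nonneg _)
  rw [← (key ha' hb).tsum_add (key (b := fun k => (k : ℝ) * b k) ha hb'), ← tsum_mul_left]
  congr 1
  ext j
  push_cast
  ring

/-- The sequence `a` represents `x = ∑ a_k u_k` in `A` and `f = ∑ a_k v_k` in `B`, and
`h = ∑ k a_k v_k`. -/
structure HasSymbol {A B : Type*} [NormedCommRing A] [NormedAlgebra ℝ A] [NormedCommRing B]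
    [NormedAlgebra ℝ B] (u : ℤ → A) (v : ℤ → B) (a : ℤ → ℝ) (x : A) (f h : B) : Prop where
  summable : Summable fun k => ‖a k‖
  summable_mul : Summable fun k : ℤ => ‖(k : ℝ) * a k‖
  hasSum : HasSum (fun k => a k • u k) x
  hasSum_symbol : HasSum (fun k => a k • v k) f
  hasSum_deriv : HasSum (fun k : ℤ => ((k : ℝ) * a k) • v k) h

/-- `u` is a homomorphism from `ℤ` to the unit ball of `A`. -/
structure IsContractiveHom {A : Type*} [NormedCommRing A] (u : ℤ → A) : Prop where
  map_zero : u 0 = 1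
  map_add : ∀ i j, u (i + j) = u i * u j
  norm_le : ∀ k, ‖u k‖ ≤ 1

variable {A B : Type*} [NormedCommRing A] [NormedAlgebra ℝ A] [NormedCommRing B]
  [NormedAlgebra ℝ B] {u : ℤ → A} {v : ℤ → B} {a b : ℤ → ℝ} {x y : A} {f g h l : B}

theorem hasSum_single_smul {B : Type*} [NormedAddCommGroup B] [NormedSpace ℝ B] (v : ℤ → B) :
    HasSum (fun k => (Pi.single 0 1 : ℤ → ℝ) k • v k) (v 0) := by
  have := hasSum_single (f := fun k => (Pi.single 0 1 : ℤ → ℝ) k • v k) 0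
    (fun k hk => by simp [Pi.single_eq_of_ne hk])
  simpa using this

theorem HasSymbol.one (hu : IsContractiveHom u) (hv : IsContractiveHom v) :
    HasSymbol u v (Pi.single 0 1) 1 1 0 := by
  have key : ∀ k : ℤ, (k : ℝ) * (Pi.single 0 1 : ℤ → ℝ) k = 0 := by
    intro k
    rcases eq_or_ne k 0 with rfl | hk
    · simp
    · simp [Pi.single_eq_of_ne hk]
  refine ⟨?_, ?_, ?_, ?_, ?_⟩
  · refine summable_of_ne_finset_zero (s := {0}) fun k hk => ?_
    simp [Pi.single_eq_of_ne (by simpa using hk : k ≠ 0)]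
  · simp [key, summable_zero]
  · simpa only [hu.map_zero] using hasSum_single_smul u
  · simpa only [hv.map_zero] using hasSum_single_smul v
  · simp only [key, zero_smul, hasSum_zero]

theorem HasSymbol.add (ha : HasSymbol u v a x f h) (hb : HasSymbol u v b y g l) :
    HasSymbol u v (a + b) (x + y) (f + g) (h + l) := by
  refine ⟨?_, ?_, ?_, ?_, ?_⟩
  · exact Summable.of_nonneg_of_le (fun _ => norm_nonneg _) (fun k => norm_add_le _ _)
      (ha.summable.add hb.summable)
  · refine Summable.of_nonneg_of_le (fun _ => norm_nonneg _) (fun k => ?_)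
      (ha.summable_mul.add hb.summable_mul)
    rw [Pi.add_apply, mul_add]
    exact norm_add_le _ _
  · simpa only [Pi.add_apply, add_smul] using ha.hasSum.add hb.hasSum
  · simpa only [Pi.add_apply, add_smul] using ha.hasSum_symbol.add hb.hasSum_symbol
  · simpa only [Pi.add_apply, mul_add, add_smul] using ha.hasSum_deriv.add hb.hasSum_deriv

theorem HasSymbol.smul (c : ℝ) (ha : HasSymbol u v a x f h) :
    HasSymbol u v (c • a) (c • x) (c • f) (c • h) := by
  refine ⟨?_, ?_, ?_, ?_, ?_⟩
  · simpa [abs_mul] using ha.summable.mul_left |c|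
  · have := ha.summable_mul.mul_left |c|
    refine this.congr fun k => ?_
    simp only [Pi.smul_apply, smul_eq_mul, norm_mul, Real.norm_eq_abs]
    ring
  · simpa only [Pi.smul_apply, smul_eq_mul, mul_smul] using ha.hasSum.const_smul c
  · simpa only [Pi.smul_apply, smul_eq_mul, mul_smul] using ha.hasSum_symbol.const_smul c
  · simpa only [Pi.smul_apply, smul_smul, smul_eq_mul, mul_left_comm c] using
      ha.hasSum_deriv.const_smul c

theorem HasSymbol.mul [CompleteSpace A] [CompleteSpace B] (hu : IsContractiveHom u)
    (hv : IsContractiveHom v)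
    (ha : HasSymbol u v a x f h) (hb : HasSymbol u v b y g l) :
    ∃ c, HasSymbol u v c (x * y) (f * g) (h * g + f * l) := by
  have hd := mul_zconv ha.summable hb.summable ha.summable_mul hb.summable_mul
  have hs1 := summable_norm_zconv ha.summable_mul hb.summable
  have hs2 := summable_norm_zconv ha.summable hb.summable_mul
  refine ⟨fun k => ∑' j, a j * b (k - j), summable_norm_zconv ha.summable hb.summable, ?_,
    hasSum_zconv hu.norm_le hu.map_add ha.summable hb.summable ha.hasSum hb.hasSum,
    hasSum_zconv hv.norm_le hv.map_add ha.summable hb.summable ha.hasSum_symbol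
      hb.hasSum_symbol, ?_⟩
  · refine Summable.of_nonneg_of_le (fun _ => norm_nonneg _) (fun k => ?_) (hs1.add hs2)
    rw [hd]
    exact norm_add_le _ _
  · have := (hasSum_zconv hv.norm_le hv.map_add ha.summable_mul hb.summable ha.hasSum_deriv
      hb.hasSum_symbol).add (hasSum_zconv hv.norm_le hv.map_add ha.summable hb.summable_mul
        ha.hasSum_symbol hb.hasSum_deriv)
    simpa only [← add_smul, ← hd] using this

theorem HasSymbol.pow [CompleteSpace A] [CompleteSpace B] (hu : IsContractiveHom u)
    (hv : IsContractiveHom v) (ha : HasSymbol u v a x f h) (N : ℕ) :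
    ∃ b, HasSymbol u v b (x ^ N) (f ^ N) ((N : ℝ) • (f ^ (N - 1) * h)) := by
  induction N with
  | zero => exact ⟨_, by simpa using HasSymbol.one hu hv⟩
  | succ N ih =>
    obtain ⟨b, hb⟩ := ih
    have key : ((N + 1 : ℕ) : ℝ) • (f ^ (N + 1 - 1) * h) =
        ((N : ℝ) • (f ^ (N - 1) * h)) * f + f ^ N * h := by
      rcases N with _ | N
      · simp
      · have h1 : f ^ N * h * f = f ^ (N + 1) * h := by ring
        simp only [Nat.add_sub_cancel, smul_mul_assoc, h1]
        push_cast
        module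
    rw [pow_succ, pow_succ, key]
    exact hb.mul hu hv ha

end Wiener

/-! ### Parseval's identity for absolutely convergent Fourier series -/

section Parseval

theorem isContractiveHom_fourier :
    IsContractiveHom (fun k => (fourier k : C(UnitAddCircle, ℂ))) where
  map_zero := by ext t; simp
  map_add i j := by ext t; exact fourier_add
  norm_le k := (fourier_norm k).le

/-- Uniform convergence passes through the continuous map to `L²`, where orthonormality identifies
the Fourier coefficients with `a`. -/
theorem hasSum_sq_of_hasSum_fourier {a : ℤ → ℝ} {f : C(UnitAddCircle, ℂ)}
    (hf : HasSum (fun k => a k • (fourier k : C(UnitAddCircle, ℂ))) f) :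
    HasSum (fun k => a k ^ 2) (∫ t, ‖f t‖ ^ 2 ∂AddCircle.haarAddCircle) := by
  have hc : ∀ k, fourierCoeff f k = a k := by
    intro k
    rw [← fourierCoeff_toLp, ← fourierBasis_repr, HilbertBasis.repr_apply_apply]
    let L : C(UnitAddCircle, ℂ) →L[ℂ] ℂ := (innerSL ℂ (fourierBasis (T := 1) k)).comp
      (ContinuousMap.toLp (E := ℂ) 2 (AddCircle.haarAddCircle (T := 1)) ℂ)
    have hL : ∀ i, L (a i • (fourier i : C(UnitAddCircle, ℂ))) = if k = i then (a k : ℂ) else 0 := by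
      intro i
      have h1 : L (fourier i) = inner ℂ (fourierLp (T := 1) 2 k) (fourierLp 2 i) := by
        simp only [L, coe_fourierBasis]; rfl
      rw [L.map_smul_of_tower, h1, (orthonormal_iff_ite.1 orthonormal_fourier) k i]
      split_ifs with hki
      · subst hki; simp
      · simp
    have h2 := (L.restrictScalars ℝ).hasSum hf
    have h3 := hasSum_ite_eq k (a k : ℂ)
    refine h2.unique ?_
    simp only [ContinuousLinearMap.coe_restrictScalars', hL]
    simpa only [eq_comm] using h3
  have h := hasSum_sq_fourierCoeff (ContinuousMap.toLp (E := ℂ) 2 AddCircle.haarAddCircle ℂ f)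
  simp_rw [fourierCoeff_toLp, hc] at h
  convert! h using 1
  · ext k; simp
  · refine integral_congr_ae ?_
    filter_upwards [ContinuousMap.coeFn_toLp (𝕜 := ℂ) (p := 2) AddCircle.haarAddCircle f] with t ht
    rw [ht]

end Parseval
-- From `ℓ²` bounds to `ℓ¹` bounds
section CauchySchwarz

theorem sq_le_mul_of_hasSum {ι : Type*} {f g : ι → ℝ} {S P Q : ℝ}
    (hS : HasSum (fun i => f i * g i) S) (hP : HasSum (fun i => f i ^ 2) P)
    (hQ : HasSum (fun i => g i ^ 2) Q) : S ^ 2 ≤ P * Q := by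
  have hS' := hS
  simp only [HasSum, SummationFilter.unconditional_filter] at hS'
  refine le_of_tendsto (hS'.pow 2) (Filter.Eventually.of_forall fun s => ?_)
  refine (Finset.sum_mul_sq_le_sq_mul_sq s f g).trans ?_
  exact mul_le_mul (sum_le_hasSum s (fun _ _ => sq_nonneg _) hP)
    (sum_le_hasSum s (fun _ _ => sq_nonneg _) hQ) (Finset.sum_nonneg fun _ _ => sq_nonneg _)
    (hP.nonneg fun _ => sq_nonneg _)

/-- Telescoping: `(b + k)(b + k + 1) ≤ (b + k + 1)² ≤ 2 (b² + (k + 1)²)` bounds each term by `2b²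
(1/(b + k) - 1/(b + k + 1))`. -/
theorem sum_range_cauchyWeight_le {b : ℝ} (hb : 0 < b) (n : ℕ) :
    ∑ k ∈ Finset.range n, b ^ 2 / (b ^ 2 + ((k : ℝ) + 1) ^ 2) ≤ 2 * b := by
  have h : ∑ k ∈ Finset.range n, b ^ 2 / (b ^ 2 + ((k : ℝ) + 1) ^ 2) ≤
      2 * b ^ 2 * (1 / b - 1 / (b + n)) := by
    induction n with
    | zero => simp
    | succ n ih =>
      rw [Finset.sum_range_succ]
      have h1 : b ^ 2 / (b ^ 2 + ((n : ℝ) + 1) ^ 2) ≤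
          2 * b ^ 2 * (1 / (b + n) - 1 / (b + (n + 1))) := by
        have e : 2 * b ^ 2 * (1 / (b + n) - 1 / (b + (n + 1))) =
            b ^ 2 * 2 / ((b + n) * (b + (n + 1))) := by
          have : b + n ≠ 0 := by positivity
          have : b + (n + 1) ≠ 0 := by positivity
          field_simp
          ring
        rw [e, div_le_div_iff₀ (by positivity) (by positivity), mul_assoc]
        refine mul_le_mul_of_nonneg_left ?_ (by positivity)
        have hn : (0 : ℝ) ≤ n := n.cast_nonneg
        nlinarith [sq_nonneg (b - (n + 1))]
      push_cast
      linarith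
  refine h.trans ?_
  have h2 : 0 ≤ 1 / (b + n) := by positivity
  calc 2 * b ^ 2 * (1 / b - 1 / (b + n)) ≤ 2 * b ^ 2 * (1 / b) := by gcongr; linarith
    _ = 2 * b := by field_simp

theorem exists_hasSum_cauchyWeight {b : ℝ} (hb : 0 < b) :
    ∃ W, HasSum (fun k : ℤ => b ^ 2 / (b ^ 2 + (k : ℝ) ^ 2)) W ∧ W ≤ 1 + 4 * b := by
  have hs : Summable fun k : ℕ => b ^ 2 / (b ^ 2 + ((k : ℝ) + 1) ^ 2) :=
    summable_of_sum_range_le (fun _ => by positivity) (sum_range_cauchyWeight_le hb)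
  have ht : ∑' k : ℕ, b ^ 2 / (b ^ 2 + ((k : ℝ) + 1) ^ 2) ≤ 2 * b :=
    Real.tsum_le_of_sum_range_le (fun _ => by positivity) (sum_range_cauchyWeight_le hb)
  have h1 : HasSum (fun k : ℕ => b ^ 2 / (b ^ 2 + (((k : ℤ) : ℝ)) ^ 2))
      (∑' k : ℕ, b ^ 2 / (b ^ 2 + ((k : ℝ) + 1) ^ 2) + 1) := by
    rw [← hasSum_nat_add_iff' 1]
    have : b ^ 2 ≠ 0 := by positivity
    simpa [this] using hs.hasSum
  have h2 : HasSum (fun k : ℕ => b ^ 2 / (b ^ 2 + (((-((k : ℤ) + 1) : ℤ) : ℝ)) ^ 2))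
      (∑' k : ℕ, b ^ 2 / (b ^ 2 + ((k : ℝ) + 1) ^ 2)) := by
    refine hs.hasSum.congr_fun ?_
    intro k
    push_cast
    ring
  exact ⟨_, h1.of_nat_of_neg_add_one h2, by linarith⟩

/-- A weighted `ℓ¹`-`ℓ²` inequality. -/
theorem sq_tsum_norm_le {M : ℤ → ℝ} {P R b : ℝ} (hb : 0 < b) (hM : Summable fun k => ‖M k‖)
    (hP : HasSum (fun k => M k ^ 2) P) (hR : HasSum (fun k : ℤ => ((k : ℝ) * M k) ^ 2) R) :
    (∑' k, ‖M k‖) ^ 2 ≤ (1 + 4 * b) * (P + R / b ^ 2) := by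
  obtain ⟨W, hW, hWb⟩ := exists_hasSum_cauchyWeight hb
  have hpos : ∀ k : ℤ, 0 < b ^ 2 + (k : ℝ) ^ 2 := fun k => by positivity
  -- The weight `1 + k²/b²` and its inverse are distributed over the two factors; the parameter `b`
  -- is kept free, to balance `P` against `R / b²` later.
  have h := sq_le_mul_of_hasSum (f := fun k : ℤ => √(b ^ 2 / (b ^ 2 + (k : ℝ) ^ 2)))
    (g := fun k : ℤ => √((b ^ 2 + (k : ℝ) ^ 2) / b ^ 2) * ‖M k‖) (S := ∑' k, ‖M k‖) (P := W)
    (Q := P + R / b ^ 2) ?_ ?_ ?_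
  · refine h.trans (mul_le_mul_of_nonneg_right hWb ?_)
    have := hP.nonneg fun _ => sq_nonneg _
    have := hR.nonneg fun _ => sq_nonneg _
    positivity
  · convert hM.hasSum using 2 with k
    rw [← mul_assoc, ← Real.sqrt_mul (by positivity), div_mul_div_comm, mul_comm (b ^ 2),
      div_self (by have := hpos k; positivity), Real.sqrt_one, one_mul]
  · convert hW using 2 with k
    rw [Real.sq_sqrt (by positivity)]
  · convert hP.add (hR.div_const (b ^ 2)) using 2 with k
    rw [mul_pow, Real.sq_sqrt (by positivity), Real.norm_eq_abs, sq_abs]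
    field_simp

end CauchySchwarz

/-! ### Integrals of `exp(-a (1 - φ))` over the circle -/

section CircleIntegral

theorem re_fourier_coe (k : ℤ) (x : ℝ) :
    (fourier k (x : UnitAddCircle)).re = Real.cos (2 * Real.pi * k * x) := by
  rw [fourier_coe_apply]
  have : 2 * (Real.pi : ℂ) * Complex.I * (k : ℂ) * (x : ℂ) / ((1 : ℝ) : ℂ) =
      ((2 * Real.pi * k * x : ℝ) : ℂ) * Complex.I := by
    push_cast
    ring
  rw [this, Complex.exp_ofReal_mul_I_re]

/-- On `|x| ≤ 1/2` one has `1 - cos 2πx ≥ 8x²`, so the integral is at most a Gaussian one, and `π <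
8`. -/
theorem integral_exp_fourier_one_le {a : ℝ} (ha : 0 < a) :
    ∫ t : UnitAddCircle, Real.exp (-a * (1 - (fourier 1 t).re)) ∂AddCircle.haarAddCircle ≤
      1 / √a := by
  rw [AddCircle.integral_haarAddCircle, inv_one, one_smul,
    ← UnitAddCircle.intervalIntegral_preimage (-(1 / 2)),
    intervalIntegral.integral_of_le (by norm_num)]
  have hg : Integrable fun x : ℝ => Real.exp (-(8 * a) * x ^ 2) :=
    integrable_exp_neg_mul_sq (by positivity)
  have hcont : Continuous fun x : ℝ => Real.exp (-a * (1 - (fourier 1 (x : UnitAddCircle)).re)) := by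
    simp only [re_fourier_coe]
    fun_prop
  calc ∫ x : ℝ in Set.Ioc (-(1 / 2)) (-(1 / 2) + 1),
        Real.exp (-a * (1 - (fourier 1 (x : UnitAddCircle)).re))
      ≤ ∫ x : ℝ in Set.Ioc (-(1 / 2)) (-(1 / 2) + 1), Real.exp (-(8 * a) * x ^ 2) := by
        refine setIntegral_mono_on ?_ hg.integrableOn measurableSet_Ioc fun x hx => ?_
        · exact (hcont.integrableOn_Icc).mono_set Set.Ioc_subset_Icc_self
        · rw [re_fourier_coe]
          refine Real.exp_le_exp.2 ?_
          have hx' : |2 * Real.pi * ((1 : ℤ) : ℝ) * x| ≤ Real.pi := by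
            rw [Int.cast_one, mul_one, abs_mul, abs_of_pos (by positivity)]
            have : |x| ≤ 1 / 2 := abs_le.2 ⟨hx.1.le, by linarith [hx.2]⟩
            nlinarith [Real.pi_pos]
          have h := Real.cos_le_one_sub_mul_cos_sq hx'
          have h' : 2 / Real.pi ^ 2 * (2 * Real.pi * ((1 : ℤ) : ℝ) * x) ^ 2 = 8 * x ^ 2 := by
            have := Real.pi_pos.ne'
            push_cast
            field_simp
            ring
          rw [h'] at h
          nlinarith
    _ ≤ ∫ x : ℝ, Real.exp (-(8 * a) * x ^ 2) :=
        setIntegral_le_integral hg (Filter.Eventually.of_forall fun x => (Real.exp_pos _).le)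
    _ = √(Real.pi / (8 * a)) := integral_gaussian _
    _ ≤ √(1 / a) := by
        refine Real.sqrt_le_sqrt ?_
        rw [div_le_div_iff₀ (by positivity) ha]
        nlinarith [Real.pi_lt_four]
    _ = 1 / √a := by rw [Real.sqrt_div zero_le_one, Real.sqrt_one]

/-- Multiplication by `k ≠ 0` preserves Haar measure on the circle, which reduces every frequency to
the first. -/
theorem integral_exp_fourier_le {a : ℝ} (ha : 0 < a) {k : ℤ} (hk : k ≠ 0) :
    ∫ t : UnitAddCircle, Real.exp (-a * (1 - (fourier k t).re)) ∂AddCircle.haarAddCircle ≤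
      1 / √a := by
  have h : ∀ t : UnitAddCircle, fourier k t = fourier 1 (k • t) := by
    intro t
    rw [fourier_one, fourier_apply]
  have hmp := Measure.measurePreserving_zsmul (AddCircle.haarAddCircle (T := 1)) hk
  have hcont : Continuous fun t : UnitAddCircle => Real.exp (-a * (1 - (fourier 1 t).re)) := by
    fun_prop
  have h2 := integral_map (φ := fun t : UnitAddCircle => k • t) (μ := AddCircle.haarAddCircle)
    hmp.measurable.aemeasurable (f := fun t => Real.exp (-a * (1 - (fourier 1 t).re)))
    hcont.aestronglyMeasurable
  rw [hmp.map_eq] at h2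
  simp only [h, ← h2]
  exact integral_exp_fourier_one_le ha

/-- Jensen's inequality, from the tangent line of `exp` at the mean `m`. -/
theorem exp_le_of_hasSum {ι : Type*} {w x : ι → ℝ} {m S : ℝ} (hw : ∀ i, 0 ≤ w i)
    (hw1 : HasSum w 1) (hm : HasSum (fun i => w i * x i) m)
    (hS : HasSum (fun i => w i * Real.exp (x i)) S) : Real.exp m ≤ S := by
  have h1 : HasSum (fun i => Real.exp m * (w i + (w i * x i - m * w i)))
      (Real.exp m * (1 + (m - m * 1))) :=
    (hw1.add (hm.sub (hw1.mul_left m))).mul_left _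
  have h2 := hasSum_le (fun i => ?_) h1 hS
  · simpa using h2
  · have h3 : Real.exp (x i) = Real.exp m * Real.exp (x i - m) := by
      rw [← Real.exp_add]; ring_nf
    have h4 := Real.add_one_le_exp (x i - m)
    rw [h3]
    have := mul_le_mul_of_nonneg_left h4 (mul_nonneg (hw i) (Real.exp_pos m).le)
    linarith

theorem norm_fourier_apply (k : ℤ) (t : UnitAddCircle) : ‖fourier k t‖ = 1 := by
  rw [fourier_apply]; exact Circle.norm_coe _

theorem re_fourier_le_one (k : ℤ) (t : UnitAddCircle) : (fourier k t).re ≤ 1 :=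
  (Complex.re_le_norm _).trans (norm_fourier_apply k t).le

/-- By Jensen the integrand is at most the `g`-average of the same expression for single characters,
each of which has integral at most `1/√a`. The trivial character, whose integral would be `1`, is
excluded by `g 0 = 0`. -/
theorem integral_exp_symbol_le {a : ℝ} (ha : 0 < a) {g : ℤ → ℝ} (hg : ∀ k, 0 ≤ g k)
    (hg1 : HasSum g 1) (hg0 : g 0 = 0) {φ : UnitAddCircle → ℝ} (hφ : Continuous φ)
    (hgφ : ∀ t, HasSum (fun k => g k * (fourier k t).re) (φ t)) :
    ∫ t, Real.exp (-a * (1 - φ t)) ∂AddCircle.haarAddCircle ≤ 1 / √a := by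
  let F : ℤ → UnitAddCircle → ℝ := fun k t => g k * Real.exp (-a * (1 - (fourier k t).re))
  have hFc : ∀ k, Continuous (F k) := fun k => by fun_prop
  have hF0 : ∀ k t, 0 ≤ F k t := fun k t => mul_nonneg (hg k) (Real.exp_pos _).le
  have hFg : ∀ k t, ‖F k t‖ ≤ g k := by
    intro k t
    rw [Real.norm_of_nonneg (hF0 k t)]
    refine mul_le_of_le_one_right (hg k) (Real.exp_le_one_iff.2 ?_)
    nlinarith [re_fourier_le_one k t]
  have hFs : ∀ t, Summable fun k => F k t := fun t =>
    Summable.of_norm_bounded hg1.summable fun k => hFg k t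
  have hFi : ∀ k, Integrable (F k) AddCircle.haarAddCircle := fun k =>
    (hFc k).integrable_of_hasCompactSupport (HasCompactSupport.of_compactSpace _)
  have hFle : ∀ k, ∫ t, F k t ∂AddCircle.haarAddCircle ≤ g k * (1 / √a) := by
    intro k
    simp only [F]
    rw [integral_const_mul]
    rcases eq_or_ne k 0 with rfl | hk
    · simp [hg0]
    · exact mul_le_mul_of_nonneg_left (integral_exp_fourier_le ha hk) (hg k)
  have hS : HasSum (fun k => ∫ t, F k t ∂AddCircle.haarAddCircle)
      (∫ t, ∑' k, F k t ∂AddCircle.haarAddCircle) := by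
    refine hasSum_integral_of_summable_integral_norm hFi ?_
    refine Summable.of_nonneg_of_le (fun k => integral_nonneg fun _ => norm_nonneg _) (fun k => ?_)
      (hg1.summable.mul_right (1 / √a))
    simpa only [Real.norm_of_nonneg (hF0 _ _)] using hFle k
  have hcont : Continuous fun t => ∑' k, F k t := continuous_tsum hFc hg1.summable hFg
  calc ∫ t, Real.exp (-a * (1 - φ t)) ∂AddCircle.haarAddCircle
      ≤ ∫ t, ∑' k, F k t ∂AddCircle.haarAddCircle := by
        refine integral_mono ((by fun_prop : Continuous fun t => Real.exp (-a * (1 - φ t))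
          ).integrable_of_hasCompactSupport (HasCompactSupport.of_compactSpace _))
          (hcont.integrable_of_hasCompactSupport (HasCompactSupport.of_compactSpace _)) fun t => ?_
        refine exp_le_of_hasSum hg hg1 ?_ (hFs t).hasSum
        have hk : ∀ k, g k * (-a * (1 - (fourier k t).re)) =
            -a * (g k - g k * (fourier k t).re) := fun k => by ring
        simpa only [hk] using (hg1.sub (hgφ t)).mul_left (-a)
    _ ≤ 1 * (1 / √a) := hasSum_le hFle hS (hg1.mul_right _)
    _ = 1 / √a := one_mul _

end CircleIntegral
-- Symbols of symmetric laws
section SymmetricSymbol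

variable {g : ℤ → ℝ} {f h : C(UnitAddCircle, ℂ)}

theorem symbol_eq_re (hsymm : ∀ k, g (-k) = g k)
    (hf : HasSum (fun k => g k • (fourier k : C(UnitAddCircle, ℂ))) f) (t : UnitAddCircle) :
    f t = ((f t).re : ℂ) := by
  have h1 : HasSum (fun k => (g k : ℂ) * fourier k t) (f t) := by
    simpa using (ContinuousMap.evalCLM ℝ t).hasSum hf
  have h2 : HasSum (fun k => (g k : ℂ) * fourier k t) ((starRingEnd ℂ) (f t)) := by
    have h3 := (Equiv.neg ℤ).hasSum_iff.2 (h1.mapL (Complex.conjCLE : ℂ →L[ℝ] ℂ))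
    simpa [Function.comp_def, hsymm, fourier_neg] using h3
  exact (Complex.conj_eq_iff_re.1 (h1.unique h2).symm).symm

theorem hasSum_re_symbol (hf : HasSum (fun k => g k • (fourier k : C(UnitAddCircle, ℂ))) f)
    (t : UnitAddCircle) : HasSum (fun k => g k * (fourier k t).re) (f t).re := by
  have h1 : HasSum (fun k => (g k : ℂ) * fourier k t) (f t) := by
    simpa using (ContinuousMap.evalCLM ℝ t).hasSum hf
  simpa using Complex.hasSum_re h1

theorem norm_fourier_sub_one_sq (k : ℤ) (t : UnitAddCircle) :
    ‖fourier k t - 1‖ ^ 2 = 2 * (1 - (fourier k t).re) := by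
  have h1 := norm_fourier_apply k t
  have h2 : ‖fourier k t‖ ^ 2 = 1 := by rw [h1, one_pow]
  rw [← Complex.normSq_eq_norm_sq, Complex.normSq_apply] at h2 ⊢
  simp only [Complex.sub_re, Complex.sub_im, Complex.one_re, Complex.one_im]
  linarith

/-- Symmetry gives `∑ k g_k = 0`, so each character `e_k` may be replaced by `e_k - 1`.
Cauchy–Schwarz then separates `|k| √g_k` from `√g_k |e_k - 1|`, and `|e_k - 1|² = 2 (1 - Re e_k)`.
-/
theorem norm_deriv_symbol_sq_le (hg : ∀ k, 0 ≤ g k) (hg1 : HasSum g 1)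
    (hsymm : ∀ k, g (-k) = g k) {σ : ℝ} (hσ : HasSum (fun k : ℤ => (k : ℝ) ^ 2 * g k) (σ ^ 2))
    (hkg : Summable fun k : ℤ => ‖(k : ℝ) * g k‖)
    (hf : HasSum (fun k => g k • (fourier k : C(UnitAddCircle, ℂ))) f)
    (hh : HasSum (fun k : ℤ => ((k : ℝ) * g k) • (fourier k : C(UnitAddCircle, ℂ))) h)
    (t : UnitAddCircle) : ‖h t‖ ^ 2 ≤ 2 * σ ^ 2 * (1 - (f t).re) := by
  have h1 : HasSum (fun k : ℤ => ((k * g k : ℝ) : ℂ) * fourier k t) (h t) := by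
    simpa using (ContinuousMap.evalCLM ℝ t).hasSum hh
  have h0 : HasSum (fun k : ℤ => ((k * g k : ℝ) : ℂ)) 0 := by
    have hs : HasSum (fun k : ℤ => (k : ℝ) * g k) (∑' k : ℤ, (k : ℝ) * g k) := hkg.of_norm.hasSum
    have hs' := (Equiv.neg ℤ).hasSum_iff.2 hs
    have hs2 : HasSum (fun k : ℤ => (k : ℝ) * g k) (-∑' k : ℤ, (k : ℝ) * g k) := by
      have := hs'.neg
      simpa [Function.comp_def, hsymm] using this
    have := hs.unique hs2
    have hz : ∑' k : ℤ, (k : ℝ) * g k = 0 := by linarith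
    rw [hz] at hs
    simpa only [Complex.ofReal_zero] using (Complex.hasSum_ofReal (f := fun k : ℤ => (k : ℝ) * g k)).2 hs
  have h2 : HasSum (fun k : ℤ => ((k * g k : ℝ) : ℂ) * (fourier k t - 1)) (h t) := by
    simpa [mul_sub] using h1.sub h0
  have hn : ∀ k : ℤ, ‖((k * g k : ℝ) : ℂ) * (fourier k t - 1)‖ =
      (|(k : ℝ)| * √(g k)) * (√(g k) * ‖fourier k t - 1‖) := by
    intro k
    rw [norm_mul, Complex.norm_real, norm_mul, Real.norm_eq_abs, Real.norm_of_nonneg (hg k)]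
    nth_rewrite 1 [← Real.mul_self_sqrt (hg k)]
    ring
  have hns : Summable fun k : ℤ => ‖((k * g k : ℝ) : ℂ) * (fourier k t - 1)‖ := by
    refine Summable.of_nonneg_of_le (fun _ => norm_nonneg _) (fun k => ?_) (hkg.mul_right 2)
    rw [norm_mul, Complex.norm_real]
    refine mul_le_mul_of_nonneg_left ((norm_sub_le _ _).trans ?_) (norm_nonneg _)
    rw [norm_fourier_apply, norm_one]
    norm_num
  have h3 : ‖h t‖ ≤ ∑' k : ℤ, ‖((k * g k : ℝ) : ℂ) * (fourier k t - 1)‖ := by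
    rw [← h2.tsum_eq]
    exact norm_tsum_le_tsum_norm hns
  have h4 := sq_le_mul_of_hasSum (f := fun k : ℤ => |(k : ℝ)| * √(g k))
    (g := fun k : ℤ => √(g k) * ‖fourier k t - 1‖) (P := σ ^ 2) (Q := 2 * (1 - (f t).re))
    (by simpa only [hn] using hns.hasSum) ?_ ?_
  · calc ‖h t‖ ^ 2 ≤ _ := pow_le_pow_left₀ (norm_nonneg _) h3 2
      _ ≤ _ := by simpa only [hn] using h4
      _ = _ := by ring
  · convert hσ using 2 with k
    rw [mul_pow, sq_abs, Real.sq_sqrt (hg k)]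
  · have hk : ∀ k : ℤ, (√(g k) * ‖fourier k t - 1‖) ^ 2 =
        2 * (g k - g k * (fourier k t).re) := by
      intro k
      rw [mul_pow, norm_fourier_sub_one_sq, Real.sq_sqrt (hg k)]
      ring
    simp only [hk]
    exact (hg1.sub (hasSum_re_symbol hf t)).mul_left 2

end SymmetricSymbol

/-! ### Pointwise estimates, with `s = 1 - φ` -/

section Scalar

/-- The minimum is forced by the two signs: `1 - q` governs the decay while the quantity is
positive, and `q` governs it near `s = 2`, where the value is `2q - 1`. -/
theorem abs_one_sub_mul_le {q s : ℝ} (hq : q ∈ Set.Ioo (0 : ℝ) 1) (hs : s ∈ Set.Icc (0 : ℝ) 2) :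
    |1 - (1 - q) * s| ≤ Real.exp (-(min q (1 - q)) * s) := by
  obtain ⟨hs0, hs2⟩ := hs
  obtain ⟨hq0, hq1⟩ := hq
  have h1 := Real.add_one_le_exp (-(min q (1 - q)) * s)
  refine le_trans (abs_le.2 ⟨?_, ?_⟩) h1
  · nlinarith [min_le_left q (1 - q)]
  · nlinarith [min_le_right q (1 - q)]

theorem mul_exp_neg_le {a s : ℝ} (ha : 0 < a) : s * Real.exp (-a * s) ≤ 1 / a := by
  rw [le_div_iff₀ ha]
  have h := Real.add_one_le_exp (a * s)
  have h2 : Real.exp (-a * s) * Real.exp (a * s) = 1 := by rw [← Real.exp_add]; simp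
  nlinarith [Real.exp_pos (-a * s)]

/-- Pointwise bound of the square of the symbol of `(T - 1) (q + (1 - q) T)^N`. -/
theorem sq_mul_pow_le {q s : ℝ} {N : ℕ} (hq : q ∈ Set.Ioo (0 : ℝ) 1)
    (hs : s ∈ Set.Icc (0 : ℝ) 2) (hN : 1 ≤ N) :
    (s * |1 - (1 - q) * s| ^ N) ^ 2 ≤
      4 / (min q (1 - q) * N) ^ 2 * Real.exp (-(min q (1 - q) * N) * s) := by
  set c := min q (1 - q) with hc
  have hc0 : 0 < c := lt_min hq.1 (sub_pos.2 hq.2)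
  have hN0 : (0 : ℝ) < N := by exact_mod_cast hN
  set a := c * N with ha
  have ha0 : 0 < a := by positivity
  have h1 : |1 - (1 - q) * s| ^ N ≤ Real.exp (-a * s) := by
    refine (pow_le_pow_left₀ (abs_nonneg _) (abs_one_sub_mul_le hq hs) N).trans_eq ?_
    rw [← Real.exp_nat_mul]
    congr 1
    rw [ha, ← hc]; ring
  have h2 : Real.exp (-a * s) = Real.exp (-(a / 2) * s) * Real.exp (-(a / 2) * s) := by
    rw [← Real.exp_add]; ring_nf
  have h3 := mul_exp_neg_le (s := s) (half_pos ha0)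
  have h4 : s * |1 - (1 - q) * s| ^ N ≤ 2 / a * Real.exp (-(a / 2) * s) := by
    calc s * |1 - (1 - q) * s| ^ N ≤ s * Real.exp (-a * s) := mul_le_mul_of_nonneg_left h1 hs.1
      _ = (s * Real.exp (-(a / 2) * s)) * Real.exp (-(a / 2) * s) := by rw [h2]; ring
      _ ≤ (1 / (a / 2)) * Real.exp (-(a / 2) * s) := by gcongr
      _ = 2 / a * Real.exp (-(a / 2) * s) := by field_simp
  calc (s * |1 - (1 - q) * s| ^ N) ^ 2 ≤ (2 / a * Real.exp (-(a / 2) * s)) ^ 2 :=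
        pow_le_pow_left₀ (mul_nonneg hs.1 (by positivity)) h4 2
    _ = 4 / a ^ 2 * Real.exp (-a * s) := by rw [h2]; ring

/-- Pointwise bound of the square of the symbol of the derivative of `(T - 1) (q + (1 - q) T)^N`,
up to the derivative of the symbol of `T`. -/
theorem mul_sq_deriv_le {q s : ℝ} {N : ℕ} (hq : q ∈ Set.Ioo (0 : ℝ) 1)
    (hs : s ∈ Set.Icc (0 : ℝ) 2) (hN : 1 ≤ N) :
    s * (|1 - (1 - q) * s| ^ N + s * (N * (1 - q) * |1 - (1 - q) * s| ^ (N - 1))) ^ 2 ≤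
      800 / (q ^ 2 * (min q (1 - q) * N)) * Real.exp (-(min q (1 - q) * N) * s) := by
  obtain ⟨hs0, hs2⟩ := id hs
  obtain ⟨hq0, hq1⟩ := id hq
  have hr := abs_one_sub_mul_le hq hs
  set c := min q (1 - q) with hc
  have hc0 : 0 < c := lt_min hq.1 (sub_pos.2 hq.2)
  have hc1 : c ≤ 1 / 2 := by
    rcases le_total q (1 - q) with h | h
    · rw [hc, min_eq_left h]; linarith
    · rw [hc, min_eq_right h]; linarith
  have hcq : (1 - q) / c ≤ 1 / q := by
    rw [div_le_div_iff₀ hc0 hq0]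
    rcases le_total q (1 - q) with h | h
    · rw [hc, min_eq_left h]; nlinarith
    · rw [hc, min_eq_right h]; nlinarith
  have hN0 : (0 : ℝ) < N := by exact_mod_cast hN
  set a := c * N with ha
  have ha0 : 0 < a := by positivity
  have hpow : ∀ m : ℕ, |1 - (1 - q) * s| ^ m ≤ Real.exp (-(c * m) * s) := by
    intro m
    refine (pow_le_pow_left₀ (abs_nonneg _) hr m).trans_eq ?_
    rw [← Real.exp_nat_mul]
    congr 1
    ring
  -- Passing from exponent `N - 1` to `N` costs `exp(c s) ≤ e < 3`, since `c ≤ 1/2` and `s ≤ 2`.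
  have h3 : Real.exp (-(c * ((N - 1 : ℕ) : ℝ)) * s) ≤ 3 * Real.exp (-a * s) := by
    have e : -(c * ((N - 1 : ℕ) : ℝ)) * s = c * s + -a * s := by
      rw [Nat.cast_sub hN, ha]; push_cast; ring
    rw [e, Real.exp_add]
    refine mul_le_mul_of_nonneg_right ?_ (Real.exp_pos _).le
    refine (Real.exp_le_exp.2 (by nlinarith : c * s ≤ 1)).trans ?_
    linarith [Real.exp_one_lt_d9]
  -- Exponent budget: `a/4` absorbs the inner factor `s`. Squaring the remaining `3a/4` gives
  -- `3a/2`, of which `a/2` absorbs the outer `s` and `a` is left.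
  have e4 : Real.exp (-a * s) = Real.exp (-(a / 4) * s) * Real.exp (-(3 * a / 4) * s) := by
    rw [← Real.exp_add]; ring_nf
  have h4 := mul_exp_neg_le (s := s) (by positivity : 0 < a / 4)
  have h5 : |1 - (1 - q) * s| ^ N + s * (N * (1 - q) * |1 - (1 - q) * s| ^ (N - 1)) ≤
      13 / q * Real.exp (-(3 * a / 4) * s) := by
    have h6 : |1 - (1 - q) * s| ^ N ≤ 1 / q * Real.exp (-(3 * a / 4) * s) := by
      have : (1 : ℝ) ≤ 1 / q := by rw [le_div_iff₀ hq0]; linarith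
      calc |1 - (1 - q) * s| ^ N ≤ 1 * Real.exp (-a * s) := by rw [one_mul]; exact hpow N
        _ ≤ 1 / q * Real.exp (-(3 * a / 4) * s) := by
          refine mul_le_mul this (Real.exp_le_exp.2 ?_) (Real.exp_pos _).le (by positivity)
          nlinarith [mul_nonneg ha0.le hs0]
    have h7 : s * (N * (1 - q) * |1 - (1 - q) * s| ^ (N - 1)) ≤
        12 / q * Real.exp (-(3 * a / 4) * s) := by
      have hq' : 0 ≤ 1 - q := by linarith
      calc s * (N * (1 - q) * |1 - (1 - q) * s| ^ (N - 1))
          ≤ s * (N * (1 - q) * (3 * Real.exp (-a * s))) := by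
            gcongr
            exact (hpow _).trans h3
        _ = 3 * N * (1 - q) * (s * Real.exp (-(a / 4) * s)) * Real.exp (-(3 * a / 4) * s) := by
            rw [e4]; ring
        _ ≤ 3 * N * (1 - q) * (1 / (a / 4)) * Real.exp (-(3 * a / 4) * s) := by gcongr
        _ = 12 * ((1 - q) / c) * Real.exp (-(3 * a / 4) * s) := by
            rw [ha]; field_simp; norm_num
        _ ≤ 12 * (1 / q) * Real.exp (-(3 * a / 4) * s) := by gcongr
        _ = _ := by ring
    calc _ ≤ 1 / q * Real.exp (-(3 * a / 4) * s) + 12 / q * Real.exp (-(3 * a / 4) * s) :=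
          add_le_add h6 h7
      _ = _ := by ring
  have h8 := mul_exp_neg_le (s := s) (half_pos ha0)
  have e8 : Real.exp (-(3 * a / 4) * s) ^ 2 = Real.exp (-(a / 2) * s) * Real.exp (-a * s) := by
    rw [← Real.exp_nat_mul, ← Real.exp_add]; push_cast; ring_nf
  have hq' : 0 ≤ 1 - q := by linarith
  calc s * (|1 - (1 - q) * s| ^ N + s * (N * (1 - q) * |1 - (1 - q) * s| ^ (N - 1))) ^ 2
      ≤ s * (13 / q * Real.exp (-(3 * a / 4) * s)) ^ 2 := by gcongr
    _ = 169 / q ^ 2 * (s * Real.exp (-(a / 2) * s)) * Real.exp (-a * s) := by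
        rw [mul_pow, e8]; ring
    _ ≤ 169 / q ^ 2 * (1 / (a / 2)) * Real.exp (-a * s) := by gcongr
    _ = 338 / (q ^ 2 * a) * Real.exp (-a * s) := by field_simp; norm_num
    _ ≤ 800 / (q ^ 2 * a) * Real.exp (-a * s) := by gcongr; norm_num

end Scalar
-- The smoothing estimate on a single line
section Smoothing

/-- `g` is a symmetric probability on `ℤ \ {0}` with standard deviation `σ`. -/
structure IsSymmetricLaw (g : ℤ → ℝ) (σ : ℝ) : Prop where
  nonneg : ∀ k, 0 ≤ g k
  hasSum_one : HasSum g 1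
  symm : ∀ k, g (-k) = g k
  zero : g 0 = 0
  sigma_nonneg : 0 ≤ σ
  hasSum_sq : HasSum (fun k : ℤ => (k : ℝ) ^ 2 * g k) (σ ^ 2)

variable {A : Type*} [NormedCommRing A] [NormedAlgebra ℝ A]
  {u : ℤ → A} {g : ℤ → ℝ} {σ : ℝ}

theorem IsSymmetricLaw.one_le_sigma (hg : IsSymmetricLaw g σ) : 1 ≤ σ := by
  have h : (1 : ℝ) ≤ σ ^ 2 := by
    refine hasSum_le (fun k => ?_) hg.hasSum_one hg.hasSum_sq
    rcases eq_or_ne k 0 with rfl | hk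
    · simp [hg.zero]
    · refine le_mul_of_one_le_left (hg.nonneg k) ?_
      have : 1 ≤ k ^ 2 := by have := sq_pos_of_ne_zero hk; omega
      exact_mod_cast this
  exact (one_le_sq_iff₀ hg.sigma_nonneg).1 h

theorem IsSymmetricLaw.summable_mul (hg : IsSymmetricLaw g σ) :
    Summable fun k : ℤ => ‖(k : ℝ) * g k‖ := by
  refine Summable.of_nonneg_of_le (fun _ => norm_nonneg _) (fun k => ?_) hg.hasSum_sq.summable
  rw [norm_mul, Real.norm_of_nonneg (hg.nonneg k), Real.norm_eq_abs]
  refine mul_le_mul_of_nonneg_right ?_ (hg.nonneg k)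
  rw [← sq_abs]
  have h : |k| ≤ |k| ^ 2 := Int.le_self_sq _
  exact_mod_cast h

theorem IsSymmetricLaw.exists_hasSymbol (hg : IsSymmetricLaw g σ) {T : A}
    (hT : HasSum (fun k => g k • u k) T) :
    ∃ f h, HasSymbol u (fun k => (fourier k : C(UnitAddCircle, ℂ))) g T f h := by
  have hgs : Summable fun k => ‖g k‖ := hg.hasSum_one.summable.norm
  have hs : ∀ {a : ℤ → ℝ}, (Summable fun k => ‖a k‖) →
      Summable fun k => a k • (fourier k : C(UnitAddCircle, ℂ)) := by
    intro a ha
    refine Summable.of_norm_bounded ha fun k => ?_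
    rw [norm_smul, fourier_norm, mul_one]
  exact ⟨_, _, hgs, hg.summable_mul, hT, (hs hgs).hasSum, (hs hg.summable_mul).hasSum⟩

theorem norm_hasSum_smul_le {a : ℤ → ℝ} {x : A} (hu : IsContractiveHom u)
    (ha : Summable fun k => ‖a k‖) (hx : HasSum (fun k => a k • u k) x) : ‖x‖ ≤ ∑' k, ‖a k‖ := by
  rw [← hx.tsum_eq]
  refine tsum_of_norm_bounded ha.hasSum fun k => ?_
  rw [norm_smul]
  exact mul_le_of_le_one_right (norm_nonneg _) (hu.norm_le k)

theorem IsSymmetricLaw.norm_le_one (hg : IsSymmetricLaw g σ) (hu : IsContractiveHom u) {T : A}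
    (hT : HasSum (fun k => g k • u k) T) : ‖T‖ ≤ 1 := by
  refine (norm_hasSum_smul_le hu hg.hasSum_one.summable.norm hT).trans_eq ?_
  simp only [Real.norm_of_nonneg (hg.nonneg _), hg.hasSum_one.tsum_eq]

theorem norm_convex_combination_le {x : A} {q : ℝ} (h1 : ‖(1 : A)‖ ≤ 1) (hx : ‖x‖ ≤ 1)
    (hq : q ∈ Set.Ioo (0 : ℝ) 1) : ‖q • (1 : A) + (1 - q) • x‖ ≤ 1 := by
  refine (norm_add_le _ _).trans ?_
  rw [norm_smul, norm_smul, Real.norm_of_nonneg hq.1.le,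
    Real.norm_of_nonneg (sub_nonneg.2 hq.2.le)]
  have := hq.1
  have := hq.2
  nlinarith

theorem norm_pow_le_one {A : Type*} [NormedCommRing A] {x : A} (h1 : ‖(1 : A)‖ ≤ 1)
    (hx : ‖x‖ ≤ 1) (n : ℕ) : ‖x ^ n‖ ≤ 1 := by
  induction n with
  | zero => simpa using h1
  | succ n ih =>
    rw [pow_succ]
    exact (norm_mul_le _ _).trans (mul_le_one₀ ih (norm_nonneg _) hx)

theorem norm_sub_one_mul_pow_le_two {A : Type*} [NormedCommRing A] {x y : A}
    (h1 : ‖(1 : A)‖ ≤ 1) (hx : ‖x‖ ≤ 1) (hy : ‖y‖ ≤ 1)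
    (n : ℕ) : ‖(x - 1) * y ^ n‖ ≤ 2 := by
  refine (norm_mul_le _ _).trans ?_
  have := (norm_sub_le x 1).trans (add_le_add hx h1)
  nlinarith [norm_pow_le_one h1 hy n, norm_nonneg (x - 1), norm_nonneg (y ^ n)]

/-- The weighted `ℓ¹`–`ℓ²` inequality and Parseval are applied to the coefficients of `(T - 1) Q^N`.
The factor `1 - φ` from the derivative bound is absorbed by the exponential, so that `σ` enters the
final estimate only as `√(1 + σ)`. -/
theorem IsSymmetricLaw.norm_sub_one_mul_pow_le_of_one_le [CompleteSpace A]
    (hg : IsSymmetricLaw g σ)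
    (hu : IsContractiveHom u) {T : A} (hT : HasSum (fun k => g k • u k) T) {q : ℝ}
    (hq : q ∈ Set.Ioo (0 : ℝ) 1) {N : ℕ} (hN : 1 ≤ N) (hN1 : 1 ≤ min q (1 - q) * N) :
    ‖(T - 1) * (q • (1 : A) + (1 - q) • T) ^ N‖ ≤
      81 * √(1 + σ) / (√q * (min q (1 - q) * N)) := by
  obtain ⟨f, h, hsym⟩ := hg.exists_hasSymbol hT
  have h1sym := HasSymbol.one hu isContractiveHom_fourier
  obtain ⟨b, hb⟩ := ((h1sym.smul q).add (hsym.smul (1 - q))).pow hu isContractiveHom_fourier N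
  obtain ⟨M, hM⟩ := (hsym.add (h1sym.smul (-1))).mul hu isContractiveHom_fourier hb
  have eT : T + (-1 : ℝ) • (1 : A) = T - 1 := by rw [neg_smul, one_smul, sub_eq_add_neg]
  rw [eT] at hM
  obtain ⟨a, ha⟩ : ∃ a, a = min q (1 - q) * N := ⟨_, rfl⟩
  rw [← ha] at hN1 ⊢
  have ha0 : 0 < a := by linarith
  have hσ1 := hg.one_le_sigma
  have hq0 := hq.1
  have hq' : 0 ≤ 1 - q := sub_nonneg.2 hq.2.le
  set φ : UnitAddCircle → ℝ := fun t => (f t).re with hφ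
  have hφc : Continuous φ := Complex.continuous_re.comp f.continuous
  have hreal : ∀ t, f t = (φ t : ℂ) := symbol_eq_re hg.symm hsym.hasSum_symbol
  have hs : ∀ t, 1 - φ t ∈ Set.Icc (0 : ℝ) 2 := by
    intro t
    have h1 : |φ t| ≤ 1 := by
      have h2 : ‖f‖ ≤ 1 := hg.norm_le_one isContractiveHom_fourier hsym.hasSum_symbol
      exact (Complex.abs_re_le_norm _).trans ((f.norm_coe_le_norm t).trans h2)
    have := abs_le.1 h1
    constructor <;> linarith
  have hint : ∀ {ψ : UnitAddCircle → ℝ}, Continuous ψ → Integrable ψ AddCircle.haarAddCircle :=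
    fun hψ => hψ.integrable_of_hasCompactSupport (HasCompactSupport.of_compactSpace _)
  have hI := integral_exp_symbol_le ha0 hg.nonneg hg.hasSum_one hg.zero hφc
    (hasSum_re_symbol hsym.hasSum_symbol)
  have hbound : ∀ {ψ : C(UnitAddCircle, ℂ)} {D : ℝ}, 0 ≤ D →
      (∀ t, ‖ψ t‖ ^ 2 ≤ D * Real.exp (-a * (1 - φ t))) →
      ∫ t, ‖ψ t‖ ^ 2 ∂AddCircle.haarAddCircle ≤ D * (1 / √a) := by
    intro ψ D hD hψ
    refine (integral_mono (hint (by fun_prop)) (hint (by fun_prop)) hψ).trans ?_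
    rw [integral_const_mul]
    exact mul_le_mul_of_nonneg_left hI hD
  have hP := hasSum_sq_of_hasSum_fourier hM.hasSum_symbol
  have hR := hasSum_sq_of_hasSum_fourier hM.hasSum_deriv
  have hQ : ∀ t, (q • (1 : C(UnitAddCircle, ℂ)) + (1 - q) • f) t =
      ((1 - (1 - q) * (1 - φ t) : ℝ) : ℂ) := by
    intro t
    simp only [ContinuousMap.add_apply, ContinuousMap.smul_apply, ContinuousMap.one_apply,
      Complex.real_smul, hreal]
    push_cast
    ring
  have hPb := hbound (ψ := (f + (-1 : ℝ) • 1) * (q • 1 + (1 - q) • f) ^ N)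
    (D := 4 / a ^ 2) (by positivity) (fun t => by
      refine le_trans (le_of_eq ?_) (ha ▸ sq_mul_pow_le hq (hs t) hN)
      rw [ContinuousMap.mul_apply, ContinuousMap.pow_apply, hQ, norm_mul, norm_pow,
        Complex.norm_real, Real.norm_eq_abs]
      congr 2
      simp only [ContinuousMap.add_apply, ContinuousMap.smul_apply, ContinuousMap.one_apply,
        Complex.real_smul, hreal]
      rw [← abs_of_nonneg (hs t).1, ← Real.norm_eq_abs, ← norm_neg (1 - φ t), ← Complex.norm_real]
      congr 1
      push_cast
      ring)
  have hRb := hbound (ψ := (h + (-1 : ℝ) • 0) * (q • 1 + (1 - q) • f) ^ N +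
      (f + (-1 : ℝ) • 1) * ((N : ℝ) • ((q • 1 + (1 - q) • f) ^ (N - 1) * (q • 0 + (1 - q) • h))))
    (D := 2 * σ ^ 2 * (800 / (q ^ 2 * a))) (by positivity) (fun t => by
      have h1 := norm_deriv_symbol_sq_le hg.nonneg hg.hasSum_one hg.symm hg.hasSum_sq
        hg.summable_mul hsym.hasSum_symbol hsym.hasSum_deriv t
      have h2 := mul_sq_deriv_le hq (hs t) hN
      rw [← ha] at h2
      have hQt := hQ t
      obtain ⟨ρ, hρ⟩ : ∃ ρ, ρ = 1 - (1 - q) * (1 - φ t) := ⟨_, rfl⟩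
      rw [← hρ] at h2 hQt
      have e : ((h + (-1 : ℝ) • 0) * (q • 1 + (1 - q) • f) ^ N +
          (f + (-1 : ℝ) • 1) * ((N : ℝ) • ((q • 1 + (1 - q) • f) ^ (N - 1) *
            (q • 0 + (1 - q) • h)))) t = h t * ((ρ ^ N -
              (1 - φ t) * (N * (1 - q) * ρ ^ (N - 1)) : ℝ) : ℂ) := by
        simp only [ContinuousMap.add_apply, ContinuousMap.mul_apply, ContinuousMap.pow_apply,
          ContinuousMap.smul_apply, ContinuousMap.one_apply, ContinuousMap.zero_apply,
          smul_zero, add_zero, zero_add, Complex.real_smul] at hQt ⊢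
        rw [hQt, hreal]
        push_cast
        ring
      have h3 : |ρ ^ N - (1 - φ t) * (N * (1 - q) * ρ ^ (N - 1))| ≤
          |ρ| ^ N + (1 - φ t) * (N * (1 - q) * |ρ| ^ (N - 1)) := by
        refine (abs_sub _ _).trans_eq ?_
        rw [abs_pow, abs_mul, abs_mul, abs_mul, abs_pow, abs_of_nonneg (hs t).1, abs_of_nonneg hq',
          Nat.abs_cast]
      rw [e, norm_mul, mul_pow, Complex.norm_real, Real.norm_eq_abs]
      calc ‖h t‖ ^ 2 * |ρ ^ N - (1 - φ t) * (N * (1 - q) * ρ ^ (N - 1))| ^ 2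
          ≤ (2 * σ ^ 2 * (1 - φ t)) *
            (|ρ| ^ N + (1 - φ t) * (N * (1 - q) * |ρ| ^ (N - 1))) ^ 2 := by
              gcongr
              exact mul_nonneg (by positivity) (hs t).1
        _ = 2 * σ ^ 2 * ((1 - φ t) *
            (|ρ| ^ N + (1 - φ t) * (N * (1 - q) * |ρ| ^ (N - 1))) ^ 2) := by ring
        _ ≤ 2 * σ ^ 2 * (800 / (q ^ 2 * a) * Real.exp (-a * (1 - φ t))) := by gcongr
        _ = _ := by ring)
  have hsa : 0 < √a := Real.sqrt_pos.2 ha0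
  have hsa2 : √a ^ 2 = a := Real.sq_sqrt ha0.le
  -- `P` is of order `a^{-5/2}` and `R` of order `σ² q^{-2} a^{-3/2}`; this `b` makes `P` and `R /
  -- b²` comparable, with constants `4 + 1600 = 1604`.
  have hmain := sq_tsum_norm_le (b := σ * √a / q) (by positivity) hM.summable hP hR
  have hnorm := norm_hasSum_smul_le hu hM.summable hM.hasSum
  refine (sq_le_sq₀ (norm_nonneg _) (by positivity)).1 ?_
  calc ‖(T - 1) * (q • (1 : A) + (1 - q) • T) ^ N‖ ^ 2 ≤ (∑' k, ‖M k‖) ^ 2 := by gcongr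
    _ ≤ _ := hmain
    _ ≤ (1 + 4 * (σ * √a / q)) * (4 / a ^ 2 * (1 / √a) +
          2 * σ ^ 2 * (800 / (q ^ 2 * a)) * (1 / √a) / (σ * √a / q) ^ 2) := by gcongr
    _ = (1 + 4 * (σ * √a / q)) * (1604 / (a ^ 2 * √a)) := by
        congr 1
        rw [div_pow, mul_pow, hsa2]
        field_simp
        norm_num
    -- Here `1 ≤ a` and `q < 1` absorb the leading `1`; the `√a` then cancels against the circle
    -- integral.
    _ ≤ (4 * (1 + σ) * √a / q) * (1604 / (a ^ 2 * √a)) := by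
        gcongr
        have h1 : 1 ≤ √a := Real.one_le_sqrt.2 hN1
        rw [le_div_iff₀ hq0, add_mul, mul_assoc 4, div_mul_cancel₀ _ hq0.ne']
        nlinarith [hq.2]
    _ = 6416 * (1 + σ) / (q * a ^ 2) := by field_simp; norm_num
    _ ≤ 81 ^ 2 * (1 + σ) / (q * a ^ 2) := by gcongr; norm_num
    _ = (81 * √(1 + σ) / (√q * a)) ^ 2 := by
        rw [div_pow, mul_pow, mul_pow, Real.sq_sqrt (by linarith), Real.sq_sqrt hq0.le]

/-- When `min q (1 - q) * N < 1` or `N = 0`, the trivial bound `2` suffices. The form `1 / (N + 1)`,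
valid for every `N`, is what the binomial and Poisson averages require. -/
theorem IsSymmetricLaw.norm_sub_one_mul_pow_le [CompleteSpace A] (hg : IsSymmetricLaw g σ)
    (hu : IsContractiveHom u) {T : A} (hT : HasSum (fun k => g k • u k) T) {q : ℝ}
    (hq : q ∈ Set.Ioo (0 : ℝ) 1) (N : ℕ) :
    ‖(T - 1) * (q • (1 : A) + (1 - q) • T) ^ N‖ ≤
      162 * √(1 + σ) / (√q * min q (1 - q)) / (N + 1) := by
  have hc0 : 0 < min q (1 - q) := lt_min hq.1 (sub_pos.2 hq.2)
  have hc1 : min q (1 - q) ≤ 1 / 2 := by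
    rcases le_total q (1 - q) with h | h
    · rw [min_eq_left h]; linarith
    · rw [min_eq_right h]; linarith
  have hsq : 0 < √q := Real.sqrt_pos.2 hq.1
  have hsq1 : √q ≤ 1 := Real.sqrt_le_one.2 hq.2.le
  have hσ : 1 ≤ √(1 + σ) := Real.one_le_sqrt.2 (by linarith [hg.sigma_nonneg])
  have h1 : ‖(1 : A)‖ ≤ 1 := hu.map_zero ▸ hu.norm_le 0
  have hTn := hg.norm_le_one hu hT
  rw [div_div]
  set c := min q (1 - q)
  by_cases h : 1 ≤ N ∧ 1 ≤ c * N
  · obtain ⟨hN, hN1⟩ := h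
    refine (hg.norm_sub_one_mul_pow_le_of_one_le hu hT hq hN hN1).trans ?_
    have hN0 : (1 : ℝ) ≤ N := by exact_mod_cast hN
    rw [div_le_div_iff₀ (by positivity) (by positivity)]
    have : (N : ℝ) + 1 ≤ 2 * N := by linarith
    calc 81 * √(1 + σ) * (√q * c * (N + 1)) ≤ 81 * √(1 + σ) * (√q * c * (2 * N)) := by gcongr
      _ = _ := by ring
  · refine (norm_sub_one_mul_pow_le_two h1 hTn (norm_convex_combination_le h1 hTn hq) N).trans ?_
    have hcN : c * (N + 1) ≤ 2 := by
      rcases Nat.eq_zero_or_pos N with rfl | hN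
      · simp; linarith
      · have : ¬ 1 ≤ c * N := fun h' => h ⟨hN, h'⟩
        linarith
    rw [le_div_iff₀ (by positivity)]
    have : √q * c * (N + 1) ≤ 2 := by nlinarith
    linarith

end Smoothing
-- Combining the lines by binomial averaging
section Mixture

theorem norm_pow_le_pow' {A : Type*} [NormedCommRing A] {x : A} {r : ℝ} (h1 : ‖(1 : A)‖ ≤ 1)
    (hr : ‖x‖ ≤ r) (n : ℕ) : ‖x ^ n‖ ≤ r ^ n := by
  induction n with
  | zero => simpa using h1
  | succ n ih =>
    rw [pow_succ, pow_succ]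
    exact (norm_mul_le _ _).trans
      (mul_le_mul ih hr (norm_nonneg _) (pow_nonneg ((norm_nonneg _).trans hr) _))

/-- From `C(N, m) / (m + 1) = C(N + 1, m + 1) / (N + 1)`, the sum is the binomial expansion of `1`
with exponent `N + 1` and its first term missing, divided by `(N + 1) π`. -/
theorem sum_choose_mul_div_le {π : ℝ} (hπ0 : 0 < π) (hπ1 : π ≤ 1) (N : ℕ) :
    ∑ m ∈ Finset.range (N + 1), (N.choose m : ℝ) * (π ^ m * (1 - π) ^ (N - m)) / (m + 1) ≤
      1 / (N + 1) / π := by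
  have h1π : 0 ≤ 1 - π := sub_nonneg.2 hπ1
  have hterm : ∀ m ∈ Finset.range (N + 1),
      (N.choose m : ℝ) * (π ^ m * (1 - π) ^ (N - m)) / (m + 1) =
        (π ^ (m + 1) * (1 - π) ^ (N + 1 - (m + 1)) * ((N + 1).choose (m + 1) : ℝ)) *
          (1 / (N + 1) / π) := by
    intro m _
    have h : ((N + 1 : ℕ) : ℝ) * (N.choose m : ℝ) = ((N + 1).choose (m + 1) : ℝ) * ((m + 1 : ℕ) : ℝ) := by
      exact_mod_cast Nat.add_one_mul_choose_eq N m
    push_cast at h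
    rw [Nat.add_sub_add_right]
    field_simp
    linear_combination (π ^ m * (1 - π) ^ (N - m)) * π * h
  rw [Finset.sum_congr rfl hterm, ← Finset.sum_mul]
  refine mul_le_of_le_one_left (by positivity) ?_
  have h := add_pow π (1 - π) (N + 1)
  rw [add_sub_cancel, one_pow, Finset.sum_range_succ'] at h
  have h0 : 0 ≤ π ^ 0 * (1 - π) ^ (N + 1 - 0) * ((N + 1).choose 0 : ℝ) := by positivity
  linarith

variable {A : Type*} [NormedCommRing A] [NormedAlgebra ℝ A]

/-- Binomial averaging: if `‖z Q^j‖ ≤ D / (j + 1)` for all `j`, then `‖z (π Q + W)^N‖` is at most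
`D / ((N + 1) π)`. -/
theorem norm_mul_add_pow_le (h1 : ‖(1 : A)‖ ≤ 1) {z Q W : A} {π D : ℝ} (hπ0 : 0 < π)
    (hπ1 : π ≤ 1) (hW : ‖W‖ ≤ 1 - π) (hQ : ∀ j : ℕ, ‖z * Q ^ j‖ ≤ D / (j + 1)) (N : ℕ) :
    ‖z * (π • Q + W) ^ N‖ ≤ D / (N + 1) / π := by
  have hD : 0 ≤ D := by simpa using (norm_nonneg _).trans (hQ 0)
  have h1π : 0 ≤ 1 - π := sub_nonneg.2 hπ1
  rw [add_pow, Finset.mul_sum]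
  refine (norm_sum_le _ _).trans ?_
  calc ∑ m ∈ Finset.range (N + 1), ‖z * ((π • Q) ^ m * W ^ (N - m) * (N.choose m : A))‖
      ≤ ∑ m ∈ Finset.range (N + 1),
          D * ((N.choose m : ℝ) * (π ^ m * (1 - π) ^ (N - m)) / (m + 1)) := by
        refine Finset.sum_le_sum fun m _ => ?_
        have e : z * ((π • Q) ^ m * W ^ (N - m) * (N.choose m : A)) =
            (N.choose m) • (π ^ m • ((z * Q ^ m) * W ^ (N - m))) := by
          rw [smul_pow, nsmul_eq_mul]
          simp only [smul_mul_assoc, mul_smul_comm]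
          congr 1
          ring
        rw [e]
        refine (norm_nsmul_le).trans ?_
        rw [norm_smul, Real.norm_of_nonneg (by positivity)]
        have h2 : ‖z * Q ^ m * W ^ (N - m)‖ ≤ D / (m + 1) * (1 - π) ^ (N - m) :=
          (norm_mul_le _ _).trans (mul_le_mul (hQ m) (norm_pow_le_pow' h1 hW _) (norm_nonneg _)
            (by positivity))
        calc (N.choose m : ℝ) * (π ^ m * ‖z * Q ^ m * W ^ (N - m)‖)
            ≤ (N.choose m : ℝ) * (π ^ m * (D / (m + 1) * (1 - π) ^ (N - m))) := by gcongr
          _ = _ := by ring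
    _ = D * ∑ m ∈ Finset.range (N + 1),
          ((N.choose m : ℝ) * (π ^ m * (1 - π) ^ (N - m)) / (m + 1)) := by rw [Finset.mul_sum]
    _ ≤ D * (1 / (N + 1) / π) := by gcongr; exact sum_choose_mul_div_le hπ0 hπ1 N
    _ = D / (N + 1) / π := by ring

variable {ι : Type*} [Fintype ι] {T : ι → A} {p : ι → ℝ} {q : ℝ}

theorem mixture_sub_one (hsum : ∑ m, p m = 1 - q) :
    q • (1 : A) + ∑ m, p m • T m - 1 = ∑ m, p m • (T m - 1) := by
  simp only [smul_sub, Finset.sum_sub_distrib, ← Finset.sum_smul, hsum]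
  module

theorem norm_mixture_le_one (h1 : ‖(1 : A)‖ ≤ 1) (hq : q ∈ Set.Ioo (0 : ℝ) 1)
    (hp : ∀ m, 0 < p m) (hsum : ∑ m, p m = 1 - q) (hT : ∀ m, ‖T m‖ ≤ 1) :
    ‖q • (1 : A) + ∑ m, p m • T m‖ ≤ 1 := by
  have h2 : ‖∑ m, p m • T m‖ ≤ ∑ m, p m := by
    refine norm_sum_le_of_le _ fun m _ => ?_
    rw [norm_smul, Real.norm_of_nonneg (hp m).le]
    exact mul_le_of_le_one_right (hp m).le (hT m)
  refine (norm_add_le _ _).trans ?_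
  rw [norm_smul, Real.norm_of_nonneg hq.1.le]
  have := mul_le_of_le_one_right hq.1.le h1
  linarith

/-- For each `m`, the mixture is `π Q_m` plus a remainder of norm at most `1 - π`, with `π = p_m /
(1 - q)`. Averaging costs `1 / π`, and multiplying by `p_m` leaves just `1 - q`. -/
theorem norm_mixture_sub_one_mul_pow_le (h1 : ‖(1 : A)‖ ≤ 1) (hq : q ∈ Set.Ioo (0 : ℝ) 1)
    (hp : ∀ m, 0 < p m) (hsum : ∑ m, p m = 1 - q) (hT : ∀ m, ‖T m‖ ≤ 1) {D : ι → ℝ}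
    (hD : ∀ m, ∀ j : ℕ,
      ‖(T m - 1) * (q • (1 : A) + (1 - q) • T m) ^ j‖ ≤ D m / (j + 1)) (N : ℕ) :
    ‖(q • (1 : A) + ∑ m, p m • T m - 1) * (q • (1 : A) + ∑ m, p m • T m) ^ N‖ ≤
      (1 - q) * (∑ m, D m) / (N + 1) := by
  classical
  have hq' : 0 < 1 - q := sub_pos.2 hq.2
  have hple : ∀ m, p m ≤ 1 - q := fun m =>
    hsum ▸ Finset.single_le_sum (fun k _ => (hp k).le) (Finset.mem_univ m)
  set Q : ι → A := fun m => q • (1 : A) + (1 - q) • T m with hQ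
  have hQn : ∀ m, ‖Q m‖ ≤ 1 := fun m => norm_convex_combination_le h1 (hT m) hq
  have hF : ∀ m, q • (1 : A) + ∑ m, p m • T m =
      (p m / (1 - q)) • Q m + ∑ k ∈ Finset.univ.erase m, (p k / (1 - q)) • Q k := by
    intro m
    rw [Finset.add_sum_erase _ (fun k => (p k / (1 - q)) • Q k) (Finset.mem_univ m)]
    simp only [hQ, smul_add, Finset.sum_add_distrib, smul_smul, ← Finset.sum_smul,
      ← Finset.sum_mul, ← Finset.sum_div, hsum, div_self hq'.ne', one_mul,
      div_mul_cancel₀ _ hq'.ne']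
  have hm : ∀ m, ‖p m • ((T m - 1) * (q • (1 : A) + ∑ m, p m • T m) ^ N)‖ ≤
      (1 - q) * D m / (N + 1) := by
    intro m
    have hpm := hp m
    rw [norm_smul, Real.norm_of_nonneg hpm.le, hF m]
    have hW : ‖∑ k ∈ Finset.univ.erase m, (p k / (1 - q)) • Q k‖ ≤ 1 - p m / (1 - q) := by
      have h2 : ∑ k ∈ Finset.univ.erase m, p k / (1 - q) = 1 - p m / (1 - q) := by
        have := Finset.add_sum_erase Finset.univ (fun k => p k / (1 - q)) (Finset.mem_univ m)
        rw [← Finset.sum_div Finset.univ, hsum, div_self hq'.ne'] at this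
        linarith
      rw [← h2]
      refine norm_sum_le_of_le _ fun k _ => ?_
      have hpk : 0 ≤ p k / (1 - q) := div_nonneg (hp k).le hq'.le
      rw [norm_smul, Real.norm_of_nonneg hpk]
      exact mul_le_of_le_one_right hpk (hQn k)
    have h3 := norm_mul_add_pow_le h1 (div_pos hpm hq') ((div_le_one hq').2 (hple m)) hW (hD m) N
    refine (mul_le_mul_of_nonneg_left h3 hpm.le).trans_eq ?_
    field_simp
  rw [mixture_sub_one hsum, Finset.sum_mul]
  simp only [smul_mul_assoc]
  refine (norm_sum_le_of_le _ fun m _ => hm m).trans_eq ?_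
  rw [← Finset.sum_div, Finset.mul_sum]

end Mixture

/-! ### Exponentials, Poisson averages and Taylor remainders -/

section Exponential

variable {A : Type*} [NormedCommRing A] [NormedAlgebra ℝ A] [CompleteSpace A]

theorem exp_mul_nat_smul (Δ : A) (a : ℝ) (n : ℕ) :
    NormedSpace.exp ((n * a) • Δ) = NormedSpace.exp (a • Δ) ^ n := by
  let _ : NormedAlgebra ℚ A := NormedAlgebra.restrictScalars ℚ ℝ A
  rw [mul_smul, Nat.cast_smul_eq_nsmul, NormedSpace.exp_nsmul]

theorem exp_smul_sub_one (x : A) (a : ℝ) :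
    NormedSpace.exp (a • (x - 1)) = Real.exp (-a) • NormedSpace.exp (a • x) := by
  let _ : NormedAlgebra ℚ A := NormedAlgebra.restrictScalars ℚ ℝ A
  have h : a • (x - 1) = algebraMap ℝ A (-a) + a • x := by
    rw [Algebra.algebraMap_eq_smul_one]; module
  rw [h, NormedSpace.exp_add, ← NormedSpace.algebraMap_exp_comm, ← Real.exp_eq_exp_ℝ,
    Algebra.algebraMap_eq_smul_one, smul_mul_assoc, one_mul]

theorem hasSum_mul_exp_smul (y x : A) (a : ℝ) :
    HasSum (fun N : ℕ => (a ^ N / N.factorial) • (y * x ^ N)) (y * NormedSpace.exp (a • x)) := by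
  have h := (NormedSpace.exp_series_hasSum_exp' (𝕂 := ℝ) (a • x)).mul_left y
  have e : ∀ N : ℕ, (a ^ N / N.factorial) • (y * x ^ N) =
      y * ((N.factorial : ℝ)⁻¹ • (a • x) ^ N) := by
    intro N
    rw [smul_pow, smul_smul, mul_smul_comm, div_eq_inv_mul]
  simpa only [e] using h

theorem hasSum_pow_div_factorial (a : ℝ) :
    HasSum (fun N : ℕ => a ^ N / N.factorial) (Real.exp a) := by
  rw [Real.exp_eq_exp_ℝ]
  exact NormedSpace.expSeries_div_hasSum_exp a

/-- For `a ≥ 0`, `exp(a (x - 1))` is the average of the powers `x^N` under Poisson weights, so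
uniform bounds pass through. -/
theorem norm_mul_exp_le {y x : A} {a B : ℝ} (ha : 0 ≤ a) (hB : ∀ N : ℕ, ‖y * x ^ N‖ ≤ B) :
    ‖y * NormedSpace.exp (a • (x - 1))‖ ≤ B := by
  have h := tsum_of_norm_bounded (f := fun N : ℕ => (a ^ N / N.factorial) • (y * x ^ N))
    ((hasSum_pow_div_factorial a).mul_right B) fun N => by
      rw [norm_smul, Real.norm_of_nonneg (by positivity)]
      exact mul_le_mul_of_nonneg_left (hB N) (by positivity)
  rw [(hasSum_mul_exp_smul y x a).tsum_eq] at h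
  rw [exp_smul_sub_one, mul_smul_comm, norm_smul, Real.norm_of_nonneg (Real.exp_pos _).le]
  calc Real.exp (-a) * ‖y * NormedSpace.exp (a • x)‖ ≤ Real.exp (-a) * (Real.exp a * B) := by gcongr
    _ = B := by rw [← mul_assoc, ← Real.exp_add]; simp

/-- Poisson averaging. -/
theorem norm_mul_exp_le_div {y x : A} {a D : ℝ} (ha : 0 < a)
    (hD : ∀ N : ℕ, ‖y * x ^ N‖ ≤ D / (N + 1)) :
    ‖y * NormedSpace.exp (a • (x - 1))‖ ≤ D / a := by
  have hD0 : 0 ≤ D := by simpa using (norm_nonneg _).trans (hD 0)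
  have hs : HasSum (fun N : ℕ => a ^ (N + 1) / (N + 1).factorial) (Real.exp a - 1) := by
    have := (hasSum_nat_add_iff' 1).2 (hasSum_pow_div_factorial a)
    simpa using this
  have h := tsum_of_norm_bounded (f := fun N : ℕ => (a ^ N / N.factorial) • (y * x ^ N))
    (hs.mul_right (D / a)) fun N => by
      rw [norm_smul, Real.norm_of_nonneg (by positivity)]
      refine (mul_le_mul_of_nonneg_left (hD N) (by positivity)).trans_eq ?_
      rw [Nat.factorial_succ]
      push_cast
      field_simp
      ring
  rw [(hasSum_mul_exp_smul y x a).tsum_eq] at h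
  rw [exp_smul_sub_one, mul_smul_comm, norm_smul, Real.norm_of_nonneg (Real.exp_pos _).le]
  calc Real.exp (-a) * ‖y * NormedSpace.exp (a • x)‖
      ≤ Real.exp (-a) * ((Real.exp a - 1) * (D / a)) := by gcongr
    _ ≤ Real.exp (-a) * (Real.exp a * (D / a)) := by gcongr; linarith
    _ = D / a := by rw [← mul_assoc, ← Real.exp_add]; simp

/-- The remainder series is dominated termwise by that of `e²`, and `e² < 8`, uniformly in the order
`k`. -/
theorem exists_exp_eq_sum_add (h1 : ‖(1 : A)‖ ≤ 1) {Δ : A} (hΔ : ‖Δ‖ ≤ 2) (k : ℕ) :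
    ∃ R : A, ‖R‖ ≤ 8 ∧ NormedSpace.exp Δ =
      ∑ j ∈ Finset.range k, (j.factorial : ℝ)⁻¹ • Δ ^ j + Δ ^ k * R := by
  have hb : ∀ j : ℕ, ‖((j + k).factorial : ℝ)⁻¹ • Δ ^ j‖ ≤ 2 ^ j / j.factorial := by
    intro j
    rw [norm_smul, Real.norm_of_nonneg (by positivity), ← div_eq_inv_mul]
    refine div_le_div₀ (by positivity) (norm_pow_le_pow' h1 hΔ j) (by positivity) ?_
    exact_mod_cast Nat.factorial_le (Nat.le_add_right j k)
  have hs : Summable fun j : ℕ => ((j + k).factorial : ℝ)⁻¹ • Δ ^ j :=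
    Summable.of_norm_bounded (hasSum_pow_div_factorial 2).summable hb
  refine ⟨∑' j : ℕ, ((j + k).factorial : ℝ)⁻¹ • Δ ^ j, ?_, ?_⟩
  · refine (tsum_of_norm_bounded (hasSum_pow_div_factorial 2) hb).trans ?_
    have h : Real.exp 2 = Real.exp 1 * Real.exp 1 := by rw [← Real.exp_add]; norm_num
    rw [h]
    nlinarith [Real.exp_one_lt_d9, Real.exp_pos 1]
  · have h2 := (hasSum_nat_add_iff' k).2 (NormedSpace.exp_series_hasSum_exp' (𝕂 := ℝ) Δ)
    have h3 := hs.hasSum.mul_left (Δ ^ k)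
    have e : ∀ j : ℕ, Δ ^ k * ((j + k).factorial : ℝ)⁻¹ • Δ ^ j =
        ((j + k).factorial : ℝ)⁻¹ • Δ ^ (j + k) := by
      intro j
      rw [mul_smul_comm, ← pow_add, add_comm]
    simp only [e] at h3
    rw [h3.unique h2, add_sub_cancel]

/-- Second-order Taylor remainder of a power at `y`, as an exact identity; every term keeps `m`
factors in all, shared between `x` and `y`, so smoothing remains available. -/
theorem pow_sub_pow_sub_eq {R : Type*} [CommRing R] (x y : R) (m : ℕ) :
    x ^ (m + 2) - y ^ (m + 2) - (m + 2 : ℕ) * (x - y) * y ^ (m + 1) =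
      (x - y) ^ 2 * ∑ j ∈ Finset.range (m + 1), ((j + 1 : ℕ) : R) * (y ^ j * x ^ (m - j)) := by
  induction m with
  | zero => simp; ring
  | succ m ih =>
    have h : ∑ j ∈ Finset.range (m + 1), ((j + 1 : ℕ) : R) * (y ^ j * x ^ (m + 1 - j)) =
        x * ∑ j ∈ Finset.range (m + 1), ((j + 1 : ℕ) : R) * (y ^ j * x ^ (m - j)) := by
      rw [Finset.mul_sum]
      refine Finset.sum_congr rfl fun j hj => ?_
      rw [Nat.sub_add_comm (Nat.lt_succ_iff.1 (Finset.mem_range.1 hj)), pow_succ]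
      ring
    rw [Finset.sum_range_succ, h, mul_add, mul_left_comm, ← ih, Nat.sub_self]
    push_cast
    ring

end Exponential
-- Approximation of powers in a Banach algebra
section Accompanying

/-- Give each of the four factors `Δ` its own `x^(N / 4)`; rounding down is harmless because `N ≤ 4
(N / 4 + 1)`. -/
theorem norm_mul_pow_four_le {A : Type*} [NormedCommRing A] {x Δ w : A} {D s : ℝ}
    (h1 : ‖(1 : A)‖ ≤ 1) (hx : ‖x‖ ≤ 1)
    (hD0 : 0 ≤ D) (hD : ∀ N : ℕ, ‖Δ * x ^ N‖ ≤ D / (N + 1)) (hw : ‖w‖ ≤ 1) {N : ℕ}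
    (hs : 0 < s) (hN : s ≤ N) : ‖Δ ^ 4 * (w * x ^ N)‖ ≤ (4 * D / s) ^ 4 := by
  obtain ⟨r, hr⟩ : ∃ r, r = N / 4 := ⟨_, rfl⟩
  have e : Δ ^ 4 * (w * x ^ N) = (Δ * x ^ r) ^ 4 * (w * x ^ (N - 4 * r)) := by
    have h2 : N = r * 4 + (N - 4 * r) := by omega
    conv_lhs => rw [h2, pow_add, pow_mul]
    ring
  have h3 : ‖Δ * x ^ r‖ ≤ 4 * D / s := by
    refine (hD r).trans ?_
    rw [div_le_div_iff₀ (by positivity) hs]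
    have h4 : (N : ℝ) ≤ 4 * (r + 1) := by
      have : N ≤ 4 * (r + 1) := by omega
      exact_mod_cast this
    nlinarith
  rw [e]
  refine (norm_mul_le _ _).trans ?_
  refine (mul_le_of_le_one_right (norm_nonneg _) ?_).trans (norm_pow_le_pow' h1 h3 4)
  exact (norm_mul_le _ _).trans (mul_le_one₀ hw (norm_nonneg _) (norm_pow_le_one h1 hx _))

variable {A : Type*} [NormedCommRing A] [NormedAlgebra ℝ A] [CompleteSpace A]

/-- The approximation theorem for `x = 1 + Δ` in a commutative Banach algebra. -/
theorem norm_pow_sub_exp_mul_le {x : A} {D : ℝ} (h1 : ‖(1 : A)‖ ≤ 1) (hx : ‖x‖ ≤ 1) (hD1 : 1 ≤ D)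
    (hD : ∀ N : ℕ, ‖(x - 1) * x ^ N‖ ≤ D / (N + 1)) {n : ℕ} (hn : 1 ≤ n) :
    ‖x ^ n - NormedSpace.exp ((n : ℝ) • (x - 1)) * (1 - ((n : ℝ) / 2) • (x - 1) ^ 2)‖ ≤
      5000000 * D ^ 4 / n ^ 2 := by
  have hD0 : 0 ≤ D := by linarith
  have hΔ : ‖x - 1‖ ≤ 2 := (norm_sub_le _ _).trans (by linarith)
  have hE1 : ∀ a : ℝ, 0 ≤ a → ‖NormedSpace.exp (a • (x - 1))‖ ≤ 1 := by
    intro a ha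
    simpa using norm_mul_exp_le (y := (1 : A)) (x := x) (B := 1) ha fun N => by
      simpa using norm_pow_le_one h1 hx N
  have hED : ∀ a : ℝ, 0 < a → ‖(x - 1) * NormedSpace.exp (a • (x - 1))‖ ≤ D / a :=
    fun a ha => norm_mul_exp_le_div ha hD
  have hD4 : 1 ≤ D ^ 4 := one_le_pow₀ hD1
  have hn0 : (0 : ℝ) < n := by exact_mod_cast hn
  -- For `n ≤ 3` the crude bound `8` is enough; `n ≥ 4` makes the splittings into three and four
  -- parts below quantitative.
  rcases Nat.lt_or_ge n 4 with hn4 | hn4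
  · have hn3 : (n : ℝ) ≤ 3 := by exact_mod_cast Nat.lt_succ_iff.1 hn4
    have h2 : ‖1 - ((n : ℝ) / 2) • (x - 1) ^ 2‖ ≤ 7 := by
      refine (norm_sub_le _ _).trans ?_
      rw [norm_smul, Real.norm_of_nonneg (by positivity)]
      have h3 := norm_pow_le_pow' h1 hΔ 2
      nlinarith [norm_nonneg ((x - 1) ^ 2)]
    calc _ ≤ ‖x ^ n‖ + ‖NormedSpace.exp ((n : ℝ) • (x - 1)) *
            (1 - ((n : ℝ) / 2) • (x - 1) ^ 2)‖ := norm_sub_le _ _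
      _ ≤ 1 + 1 * 7 := add_le_add (norm_pow_le_one h1 hx n)
          ((norm_mul_le _ _).trans (mul_le_mul (hE1 _ hn0.le) h2 (norm_nonneg _) zero_le_one))
      _ ≤ 5000000 * D ^ 4 / n ^ 2 := by
          rw [le_div_iff₀ (by positivity)]
          nlinarith
  obtain ⟨m, rfl⟩ : ∃ m, n = m + 2 := ⟨n - 2, by omega⟩
  have hn4' : (4 : ℝ) ≤ ((m + 2 : ℕ) : ℝ) := by exact_mod_cast hn4
  obtain ⟨R1, hR1, hy1⟩ := exists_exp_eq_sum_add h1 hΔ 1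
  obtain ⟨R2, hR2, hy2⟩ := exists_exp_eq_sum_add h1 hΔ 2
  obtain ⟨R3, hR3, hy3⟩ := exists_exp_eq_sum_add h1 hΔ 3
  have hyn : ∀ k : ℕ, NormedSpace.exp (x - 1) ^ k = NormedSpace.exp ((k : ℝ) • (x - 1)) := by
    intro k
    have := exp_mul_nat_smul (x - 1) 1 k
    rw [mul_one, one_smul] at this
    exact this.symm
  set y := NormedSpace.exp (x - 1) with hy
  set Δ := x - 1 with hΔdef
  set n : ℕ := m + 2 with hnm
  have hxΔ : x = 1 + Δ := by rw [hΔdef]; ring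
  have hxy : x - y = -(Δ ^ 2 * R2) := by
    rw [hy2, hxΔ]
    simp [Finset.sum_range_succ]
  -- To second order `x - y` is `-Δ²/2`; adding `yΔ²/2`, the correction already carried by the
  -- approximant, leaves only third order.
  have hcorr : (x - y) + (2 : ℝ)⁻¹ • (y * Δ ^ 2) = Δ ^ 3 * ((2 : ℝ)⁻¹ • R1 - R3) := by
    have e1 : (x - y) = - ((2 : ℝ)⁻¹ • Δ ^ 2 + Δ ^ 3 * R3) := by
      rw [hy3, hxΔ]
      simp [Finset.sum_range_succ]
      ring
    have e2 : y * Δ ^ 2 = Δ ^ 2 + Δ ^ 3 * R1 := by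
      rw [hy1]
      simp
      ring
    rw [e1, e2, smul_add, mul_sub, mul_smul_comm]
    abel
  have hdecomp : x ^ n - NormedSpace.exp ((n : ℝ) • Δ) * (1 - ((n : ℝ) / 2) • Δ ^ 2) =
      Δ ^ 4 * R2 ^ 2 * ∑ j ∈ Finset.range (m + 1), ((j + 1 : ℕ) : A) * (y ^ j * x ^ (m - j)) +
        (n : ℝ) • (Δ ^ 3 * y ^ (m + 1) * ((2 : ℝ)⁻¹ • R1 - R3)) := by
    have h3 := pow_sub_pow_sub_eq x y m
    rw [← hyn, show Δ ^ 4 * R2 ^ 2 = (x - y) ^ 2 by rw [hxy]; ring, ← h3,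
      show Δ ^ 3 * y ^ (m + 1) * ((2 : ℝ)⁻¹ • R1 - R3) =
        y ^ (m + 1) * ((x - y) + (2 : ℝ)⁻¹ • (y * Δ ^ 2)) by rw [hcorr]; ring,
      mul_add, smul_add, mul_smul_comm, smul_smul, Nat.cast_smul_eq_nsmul, nsmul_eq_mul, mul_sub,
      mul_smul_comm, div_eq_mul_inv]
    rw [show y ^ (m + 1) * (y * Δ ^ 2) = y ^ n * Δ ^ 2 by rw [hnm]; ring]
    ring
  have hterm : ∀ j ∈ Finset.range (m + 1), ‖Δ ^ 4 * (y ^ j * x ^ (m - j))‖ ≤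
      (16 * D / n) ^ 4 := by
    intro j hj
    have hjm : j ≤ m := Nat.lt_succ_iff.1 (Finset.mem_range.1 hj)
    have hyj : ‖y ^ j‖ ≤ 1 := by rw [hyn]; exact hE1 _ (Nat.cast_nonneg _)
    have e16 : 16 * D / n = 4 * D / (n / 4) := by field_simp; norm_num
    -- The larger of the two exponents is at least `n/4`, so its power supplies the smoothing and
    -- the other is bounded by `1`.
    rcases Nat.lt_or_ge (2 * j) m with h | h
    · rw [e16]
      refine norm_mul_pow_four_le h1 hx hD0 hD hyj (by positivity) ?_
      have : n ≤ 4 * (m - j) := by omega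
      have : (n : ℝ) ≤ 4 * ((m - j : ℕ) : ℝ) := by exact_mod_cast this
      linarith
    · have h5 : n ≤ 4 * j := by omega
      have h5' : (n : ℝ) ≤ 4 * j := by exact_mod_cast h5
      have e : Δ ^ 4 * (y ^ j * x ^ (m - j)) =
          (Δ * NormedSpace.exp ((j / 4 : ℝ) • Δ)) ^ 4 * x ^ (m - j) := by
        have : y ^ j = NormedSpace.exp ((j / 4 : ℝ) • Δ) ^ 4 := by
          rw [hyn, ← exp_mul_nat_smul]
          congr 2
          push_cast
          ring
        rw [this]
        ring
      rw [e]
      refine (norm_mul_le _ _).trans ((mul_le_of_le_one_right (norm_nonneg _)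
        (norm_pow_le_one h1 hx _)).trans (norm_pow_le_pow' h1 ((hED _ (by linarith)).trans ?_) 4))
      rw [div_le_div_iff₀ (by linarith) hn0]
      nlinarith
  have hsum : ‖Δ ^ 4 * R2 ^ 2 *
      ∑ j ∈ Finset.range (m + 1), ((j + 1 : ℕ) : A) * (y ^ j * x ^ (m - j))‖ ≤
      n * (n * (64 * (16 * D / n) ^ 4)) := by
    rw [Finset.mul_sum]
    calc _ ≤ ∑ j ∈ Finset.range (m + 1), n * (64 * (16 * D / n) ^ 4) := by
          refine norm_sum_le_of_le _ fun j hj => ?_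
          have e : Δ ^ 4 * R2 ^ 2 * (((j + 1 : ℕ) : A) * (y ^ j * x ^ (m - j))) =
              (j + 1) • (R2 ^ 2 * (Δ ^ 4 * (y ^ j * x ^ (m - j)))) := by
            rw [nsmul_eq_mul]; ring
          rw [e]
          refine norm_nsmul_le.trans ?_
          have hj' : ((j + 1 : ℕ) : ℝ) ≤ n := by
            have := Finset.mem_range.1 hj
            exact_mod_cast (by omega : j + 1 ≤ n)
          refine mul_le_mul hj' ((norm_mul_le _ _).trans (mul_le_mul ?_ (hterm j hj)
            (norm_nonneg _) (by norm_num))) (norm_nonneg _) hn0.le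
          refine (norm_pow_le_pow' h1 hR2 2).trans (by norm_num)
      _ = (m + 1 : ℕ) * (n * (64 * (16 * D / n) ^ 4)) := by
          rw [Finset.sum_const, Finset.card_range, nsmul_eq_mul]
      _ ≤ _ := by
          gcongr
          omega
  have hm1 : (0 : ℝ) < ((m + 1 : ℕ) : ℝ) / 3 := by positivity
  have hthird : ‖(n : ℝ) • (Δ ^ 3 * y ^ (m + 1) * ((2 : ℝ)⁻¹ • R1 - R3))‖ ≤
      n * ((4 * D / n) ^ 3 * 12) := by
    rw [norm_smul, Real.norm_of_nonneg hn0.le]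
    refine mul_le_mul_of_nonneg_left ?_ hn0.le
    refine (norm_mul_le _ _).trans (mul_le_mul ?_ ?_ (norm_nonneg _) (by positivity))
    · have e : Δ ^ 3 * y ^ (m + 1) = (Δ * NormedSpace.exp ((((m + 1 : ℕ) : ℝ) / 3) • Δ)) ^ 3 := by
        have : y ^ (m + 1) = NormedSpace.exp ((((m + 1 : ℕ) : ℝ) / 3) • Δ) ^ 3 := by
          rw [hyn, ← exp_mul_nat_smul]
          congr 2
          push_cast
          ring
        rw [this]
        ring
      rw [e]
      refine norm_pow_le_pow' h1 ((hED _ hm1).trans ?_) 3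
      rw [div_le_div_iff₀ hm1 hn0]
      have h6 : (n : ℝ) * 3 ≤ 4 * ((m + 1 : ℕ) : ℝ) := by
        have : n * 3 ≤ 4 * (m + 1) := by omega
        exact_mod_cast this
      nlinarith
    · refine (norm_sub_le _ _).trans ?_
      rw [norm_smul, Real.norm_of_nonneg (by norm_num)]
      linarith
  rw [hdecomp]
  refine (norm_add_le _ _).trans ((add_le_add hsum hthird).trans ?_)
  have hD34 : D ^ 3 ≤ D ^ 4 := pow_le_pow_right₀ hD1 (by norm_num)
  have e : (n : ℝ) * (n * (64 * (16 * D / n) ^ 4)) + n * ((4 * D / n) ^ 3 * 12) =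
      (4194304 * D ^ 4 + 768 * D ^ 3) / n ^ 2 := by
    field_simp
    ring
  rw [e]
  gcongr
  linarith

end Accompanying

/-! ### The approximation bound for mixtures, with its dependence on `q` -/

section AbstractMixture

/-- The approximation theorem for a mixture of symmetric laws on cyclic subgroups, in a commutative
Banach algebra. -/
theorem norm_mixture_pow_sub_exp_mul_le {A : Type*} [NormedCommRing A] [NormedAlgebra ℝ A]
    [CompleteSpace A] (h1 : ‖(1 : A)‖ ≤ 1) {ι : Type*} [Fintype ι] [Nonempty ι] {u : ι → ℤ → A}
    (hu : ∀ m, IsContractiveHom (u m)) {g : ι → ℤ → ℝ} {σ : ι → ℝ}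
    (hg : ∀ m, IsSymmetricLaw (g m) (σ m)) {T : ι → A}
    (hT : ∀ m, HasSum (fun k => g m k • u m k) (T m)) {p : ι → ℝ} {q : ℝ}
    (hq : q ∈ Set.Ioo (0 : ℝ) 1) (hp : ∀ m, 0 < p m) (hsum : ∑ m, p m = 1 - q) {x : A}
    (hx : x = q • (1 : A) + ∑ m, p m • T m) {n : ℕ} (hn : 1 ≤ n) :
    ‖x ^ n - NormedSpace.exp ((n : ℝ) • (x - 1)) * (1 - ((n : ℝ) / 2) • (x - 1) ^ 2)‖ ≤
      5000000 * 162 ^ 4 / (n ^ 2 * q ^ (13 / 2 : ℝ)) * (∑ m, √(1 + σ m)) ^ 4 := by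
  have hq0 := hq.1
  have hq' : 0 < 1 - q := sub_pos.2 hq.2
  have hsq : 0 < √q := Real.sqrt_pos.2 hq0
  have hsq1 : √q ≤ 1 := Real.sqrt_le_one.2 hq.2.le
  have hTn : ∀ m, ‖T m‖ ≤ 1 := fun m => (hg m).norm_le_one (hu m) (hT m)
  set S := ∑ m, √(1 + σ m) with hS
  have hS1 : 1 ≤ S := by
    obtain ⟨m⟩ := ‹Nonempty ι›
    refine le_trans ?_ (Finset.single_le_sum (fun k _ => Real.sqrt_nonneg (1 + σ k))
      (Finset.mem_univ m))
    exact Real.one_le_sqrt.2 (by linarith [(hg m).sigma_nonneg])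
  set D := 162 * S / (√q * q) with hDdef
  have hc0 : 0 < min q (1 - q) := lt_min hq0 hq'
  -- This ratio combines `1 - q` from the averaging with `min q (1 - q)` from each line, so there is
  -- no loss as `q` tends to `1`.
  have hcq : (1 - q) / min q (1 - q) ≤ 1 / q := by
    rw [div_le_div_iff₀ hc0 hq0]
    rcases le_total q (1 - q) with h | h
    · rw [min_eq_left h]; nlinarith
    · rw [min_eq_right h]; nlinarith [hq.2]
  have hD : ∀ N : ℕ, ‖(x - 1) * x ^ N‖ ≤ D / (N + 1) := by
    intro N
    rw [hx]
    refine (norm_mixture_sub_one_mul_pow_le h1 hq hp hsum hTn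
      (fun m j => (hg m).norm_sub_one_mul_pow_le (hu m) (hT m) hq j) N).trans ?_
    gcongr
    rw [← Finset.sum_div, ← Finset.mul_sum, ← hS]
    calc (1 - q) * (162 * S / (√q * min q (1 - q)))
        = 162 * S / √q * ((1 - q) / min q (1 - q)) := by field_simp
      _ ≤ 162 * S / √q * (1 / q) := by gcongr
      _ = D := by rw [hDdef]; field_simp
  have hD1 : 1 ≤ D := by
    rw [hDdef, le_div_iff₀ (by positivity)]
    nlinarith [hq.2]
  have hxn : ‖x‖ ≤ 1 := hx ▸ norm_mixture_le_one h1 hq hp hsum hTn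
  refine (norm_pow_sub_exp_mul_le h1 hxn hD1 hD hn).trans ?_
  have hn0 : (0 : ℝ) < n := by exact_mod_cast hn
  have hqp : q ^ (13 / 2 : ℝ) ≤ q ^ 6 := by
    rw [← Real.rpow_natCast]
    exact Real.rpow_le_rpow_of_exponent_ge hq0 hq.2.le (by norm_num)
  have hqp0 : 0 < q ^ (13 / 2 : ℝ) := Real.rpow_pos_of_pos hq0 _
  have hsq4 : √q ^ 4 = q ^ 2 := by
    rw [show √q ^ 4 = (√q ^ 2) ^ 2 by ring, Real.sq_sqrt hq0.le]
  calc 5000000 * D ^ 4 / (n : ℝ) ^ 2 = 5000000 * 162 ^ 4 / (n ^ 2 * q ^ 6) * S ^ 4 := by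
        rw [hDdef, div_pow, mul_pow _ q, hsq4]
        field_simp
    _ ≤ 5000000 * 162 ^ 4 / (n ^ 2 * q ^ (13 / 2 : ℝ)) * S ^ 4 := by gcongr

end AbstractMixture
-- The commutative Banach algebra generated by translations
section ShiftAlgebra

variable {E : Type} [AddCommGroup E]

/-- Translation by `v` on bounded functions on `E`. -/
noncomputable def shift (v : E) :
    lp (fun _ : E => ℝ) ⊤ →L[ℝ] lp (fun _ : E => ℝ) ⊤ :=
  LinearMap.mkContinuous
    { toFun := fun f => ⟨fun y => f (y + v), memℓp_infty ⟨‖f‖, by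
        rintro _ ⟨y, rfl⟩
        exact lp.norm_apply_le_norm ENNReal.top_ne_zero f (y + v)⟩⟩
      map_add' := fun f g => rfl
      map_smul' := fun c f => rfl } 1
    (fun f => by
      rw [one_mul]
      exact lp.norm_le_of_forall_le (norm_nonneg _) fun y =>
        lp.norm_apply_le_norm ENNReal.top_ne_zero f (y + v))

theorem shift_apply (v : E) (f : lp (fun _ : E => ℝ) ⊤) (y : E) : shift v f y = f (y + v) := rfl

theorem shift_zero : shift (0 : E) = 1 := by
  ext f y
  simp [shift_apply]

theorem shift_add (v w : E) : shift (v + w) = shift v * shift w := by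
  ext f y
  simp [shift_apply, add_assoc]

theorem norm_shift_le (v : E) : ‖shift v‖ ≤ 1 := LinearMap.mkContinuous_norm_le _ zero_le_one _

/-- The indicator function of a set, as a bounded function. -/
noncomputable def boundedIndicator {E : Type} (B : Set E) : lp (fun _ : E => ℝ) ⊤ :=
  ⟨B.indicator 1, memℓp_infty ⟨1, by
    rintro _ ⟨y, rfl⟩
    by_cases h : y ∈ B <;> simp [h]⟩⟩

theorem boundedIndicator_apply {E : Type} (B : Set E) (y : E) :
    boundedIndicator B y = B.indicator (1 : E → ℝ) y := rfl

theorem norm_boundedIndicator_le {E : Type} (B : Set E) : ‖boundedIndicator B‖ ≤ 1 :=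
  lp.norm_le_of_forall_le zero_le_one fun y => by
    rw [boundedIndicator_apply]
    by_cases h : y ∈ B <;> simp [h]

/-- The closed algebra generated by the translations. -/
noncomputable def shiftAlgebra (E : Type) [AddCommGroup E] :
    Subalgebra ℝ (lp (fun _ : E => ℝ) ⊤ →L[ℝ] lp (fun _ : E => ℝ) ⊤) :=
  (Algebra.adjoin ℝ (Set.range (shift (E := E)))).topologicalClosure

theorem shift_mul_comm (v w : E) : shift v * shift w = shift w * shift v := by
  rw [← shift_add, ← shift_add, add_comm]

noncomputable instance : NormedCommRing (shiftAlgebra E) :=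
  { (inferInstance : NormedRing (shiftAlgebra E)) with
    mul_comm := (Subalgebra.commRingTopologicalClosure (Algebra.adjoin ℝ (Set.range (shift (E := E))))
      (Algebra.isMulCommutative_adjoin ℝ (by
        rintro _ ⟨v, rfl⟩ _ ⟨w, rfl⟩
        exact shift_mul_comm v w)).is_comm.comm).mul_comm }

noncomputable instance : NormedAlgebra ℝ (shiftAlgebra E) :=
  { (inferInstance : Algebra ℝ (shiftAlgebra E)) with
    norm_smul_le := fun c x => norm_smul_le c (x : lp (fun _ : E => ℝ) ⊤ →L[ℝ] lp (fun _ : E => ℝ) ⊤) }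

instance : CompleteSpace (shiftAlgebra E) :=
  (Subalgebra.isClosed_topologicalClosure _).completeSpace_coe

/-- Translation as an element of the algebra `shiftAlgebra E`. -/
noncomputable def shiftElem (v : E) : shiftAlgebra E :=
  ⟨shift v, Subalgebra.le_topologicalClosure _ (Algebra.subset_adjoin ⟨v, rfl⟩)⟩

theorem shiftElem_zero : shiftElem (0 : E) = 1 := Subtype.ext shift_zero

theorem shiftElem_add (v w : E) : shiftElem (v + w) = shiftElem v * shiftElem w :=
  Subtype.ext (shift_add v w)

theorem norm_shiftElem_le (v : E) : ‖shiftElem v‖ ≤ 1 := norm_shift_le v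

/-- The functional `T ↦ (T 1_B)(0)`. -/
noncomputable def evalSet (B : Set E) : shiftAlgebra E →ₗ[ℝ] ℝ where
  toFun T := (T : lp (fun _ : E => ℝ) ⊤ →L[ℝ] lp (fun _ : E => ℝ) ⊤) (boundedIndicator B) 0
  map_add' _ _ := rfl
  map_smul' _ _ := rfl

theorem norm_evalSet_le (B : Set E) (T : shiftAlgebra E) : ‖evalSet B T‖ ≤ 1 * ‖T‖ := by
  refine (lp.norm_apply_le_norm ENNReal.top_ne_zero _ _).trans ?_
  refine (ContinuousLinearMap.le_opNorm _ _).trans ?_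
  rw [mul_comm]
  exact mul_le_mul_of_nonneg_right (norm_boundedIndicator_le B) (norm_nonneg _)

theorem evalSet_shiftElem (B : Set E) (v : E) :
    evalSet B (shiftElem v) = B.indicator (1 : E → ℝ) v := by
  change shift v (boundedIndicator B) 0 = _
  rw [shift_apply, zero_add, boundedIndicator_apply]

end ShiftAlgebra

/-! ### Atomic signed measures and their images in the algebra -/

section Atomic

variable {X : Type*} [MeasurableSpace X]

/-- The unit mass at `x`. -/
noncomputable def pointMass (x : X) : SignedMeasure X := VectorMeasure.dirac x 1

theorem norm_pointMass_apply_le (x : X) (B : Set X) : ‖pointMass x B‖ ≤ 1 := by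
  by_cases hB : MeasurableSet B
  · by_cases hx : x ∈ B
    · rw [pointMass, VectorMeasure.dirac_apply_of_mem hB hx, norm_one]
    · rw [pointMass, VectorMeasure.dirac_apply_of_notMem hx, norm_zero]; exact zero_le_one
  · rw [VectorMeasure.not_measurable _ hB, norm_zero]; exact zero_le_one

theorem pointMass_apply {x : X} {B : Set X} (hB : MeasurableSet B) :
    pointMass x B = B.indicator (1 : X → ℝ) x := by
  by_cases hx : x ∈ B
  · rw [pointMass, VectorMeasure.dirac_apply_of_mem hB hx, Set.indicator_of_mem hx, Pi.one_apply]
  · rw [pointMass, VectorMeasure.dirac_apply_of_notMem hx, Set.indicator_of_notMem hx]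

theorem summable_mul_pointMass {ι : Type*} {a : ι → ℝ} (ha : Summable fun i => ‖a i‖) (v : ι → X)
    (B : Set X) : Summable fun i => a i * pointMass (v i) B := by
  refine Summable.of_norm_bounded ha fun i => ?_
  rw [norm_mul]
  exact mul_le_of_le_one_right (norm_nonneg _) (norm_pointMass_apply_le _ _)

/-- The atomic signed measure `∑ a_i δ_{v_i}`. -/
noncomputable def atomicMeasure {ι : Type*} (a : ι → ℝ) (v : ι → X)
    (ha : Summable fun i => ‖a i‖) : SignedMeasure X where
  measureOf' B := ∑' i, a i * pointMass (v i) B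
  empty' := by simp
  not_measurable' B hB := by simp [VectorMeasure.not_measurable _ hB]
  m_iUnion' f hf hd := by
    have hfin : ∀ (s : Finset ℕ) (i : ι),
        ∑ k ∈ s, a i * pointMass (v i) (f k) = a i * pointMass (v i) (⋃ k ∈ s, f k) := by
      intro s i
      rw [← Finset.mul_sum, VectorMeasure.of_biUnion_finset]
      · exact fun k _ l _ hkl => hd hkl
      · exact fun k _ => hf k
    have hlim : Filter.Tendsto
        (fun s : Finset ℕ => ∑' i, ∑ k ∈ s, a i * pointMass (v i) (f k))
        Filter.atTop (nhds (∑' i, a i * pointMass (v i) (⋃ k, f k))) := by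
      refine tendsto_tsum_of_dominated_convergence ha ?_ ?_
      · intro i
        exact ((pointMass (v i)).m_iUnion hf hd).mul_left _
      · refine Filter.Eventually.of_forall fun s i => ?_
        rw [hfin, norm_mul]
        exact mul_le_of_le_one_right (norm_nonneg _) (norm_pointMass_apply_le _ _)
    simp only [HasSum, SummationFilter.unconditional_filter]
    refine hlim.congr fun s => ?_
    rw [Summable.tsum_finsetSum fun k _ => summable_mul_pointMass ha v (f k)]

theorem hasSum_atomicMeasure {ι : Type*} {a : ι → ℝ} (v : ι → X)
    (ha : Summable fun i => ‖a i‖) (B : Set X) :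
    HasSum (fun i => a i * pointMass (v i) B) (atomicMeasure a v ha B) :=
  (summable_mul_pointMass ha v B).hasSum

/-- `M = ∑ a_i δ_{v_i}` and `T = ∑ a_i U(v_i)` for some family with `∑ |a_i| ≤ c`. -/
def IsAtomic {A : Type*} [NormedCommRing A] [NormedAlgebra ℝ A] (U : X → A) (M : SignedMeasure X)
    (T : A) (c : ℝ) : Prop :=
  ∃ (ι : Type) (a : ι → ℝ) (v : ι → X), (Summable fun i => ‖a i‖) ∧ ∑' i, ‖a i‖ ≤ c ∧
    (∀ B, HasSum (fun i => a i * pointMass (v i) B) (M B)) ∧ HasSum (fun i => a i • U (v i)) T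

variable {A : Type*} [NormedCommRing A] [NormedAlgebra ℝ A] {U : X → A} {M V : SignedMeasure X}
  {S T : A} {c e : ℝ}

theorem IsAtomic.nonneg (h : IsAtomic U M T c) : 0 ≤ c := by
  obtain ⟨ι, a, v, -, hc, -, -⟩ := h
  exact (tsum_nonneg fun _ => norm_nonneg _).trans hc

theorem IsAtomic.add (hM : IsAtomic U M S c) (hV : IsAtomic U V T e) :
    IsAtomic U (M + V) (S + T) (c + e) := by
  obtain ⟨ι, a, v, ha, hac, hM, hS⟩ := hM
  obtain ⟨κ, b, w, hb, hbc, hV, hT⟩ := hV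
  have hn := HasSum.sum (f := fun i : ι ⊕ κ => ‖(Sum.elim a b) i‖) ha.hasSum hb.hasSum
  refine ⟨ι ⊕ κ, Sum.elim a b, Sum.elim v w, hn.summable, ?_, fun B => ?_, ?_⟩
  · rw [hn.tsum_eq]
    exact add_le_add hac hbc
  · exact HasSum.sum (f := fun i => (Sum.elim a b) i * pointMass ((Sum.elim v w) i) B) (hM B) (hV B)
  · exact HasSum.sum (f := fun i => (Sum.elim a b) i • U ((Sum.elim v w) i)) hS hT

theorem IsAtomic.smul (r : ℝ) (hM : IsAtomic U M S c) : IsAtomic U (r • M) (r • S) (|r| * c) := by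
  obtain ⟨ι, a, v, ha, hac, hM, hS⟩ := hM
  refine ⟨ι, fun i => r * a i, v, ?_, ?_, fun B => ?_, ?_⟩
  · simpa only [norm_mul] using ha.mul_left ‖r‖
  · simp only [norm_mul, tsum_mul_left]
    exact mul_le_mul_of_nonneg_left hac (abs_nonneg r)
  · have h : (r • M) B = r * M B := rfl
    simpa only [mul_assoc, h] using (hM B).mul_left r
  · simpa only [mul_smul] using hS.const_smul r

theorem IsAtomic.sub (hM : IsAtomic U M S c) (hV : IsAtomic U V T e) :
    IsAtomic U (M - V) (S - T) (c + e) := by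
  have h := hM.add (hV.smul (-1))
  have e1 : M + (-1 : ℝ) • V = M - V := by
    ext B _
    change M B + (-1) * V B = M B - V B
    ring
  rwa [e1, neg_smul, one_smul, ← sub_eq_add_neg, abs_neg, abs_one, one_mul] at h

theorem isAtomic_zero : IsAtomic U (0 : SignedMeasure X) 0 0 := by
  refine ⟨Empty, Empty.elim, Empty.elim, (hasSum_fintype _).summable, by simp, fun B => ?_, ?_⟩
  · simp
  · simp

theorem isAtomic_sum {κ : Type*} (s : Finset κ) {M : κ → SignedMeasure X} {T : κ → A} {c : κ → ℝ}
    (h : ∀ m, IsAtomic U (M m) (T m) (c m)) :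
    IsAtomic U (∑ m ∈ s, M m) (∑ m ∈ s, T m) (∑ m ∈ s, c m) := by
  classical
  induction s using Finset.induction_on with
  | empty => simpa using isAtomic_zero
  | insert m s hm ih =>
    simp only [Finset.sum_insert hm]
    exact (h m).add ih

end Atomic

/-! ### Convolution and exponential of atomic measures -/

section AtomicAlgebra

variable {E : Type*} [AddCommGroup E] [MeasurableSpace E] {A : Type*} [NormedCommRing A]
  [NormedAlgebra ℝ A] {U : E → A} {M V : SignedMeasure E} {S T : A} {c e : ℝ}

theorem isAtomic_unitMass (h0 : U 0 = 1) : IsAtomic U (unitMass E) 1 1 := by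
  refine ⟨Unit, fun _ => 1, fun _ => 0, ?_, ?_, fun B => ?_, ?_⟩
  · exact (hasSum_fintype _).summable
  · simp
  · simp [unitMass, pointMass]
  · simp [h0]

variable [MeasurableAdd₂ E] [CompleteSpace A]

/-- On rectangles the product measure agrees with the atomic measure at the pairs `(v_i, w_j)`,
hence equals it; addition then moves the atoms to `v_i + w_j`. -/
theorem IsAtomic.conv (hadd : ∀ v w, U (v + w) = U v * U w) (hU : ∀ v, ‖U v‖ ≤ 1)
    (hM : IsAtomic U M S c) (hV : IsAtomic U V T e) :
    IsAtomic U (conv M V) (S * T) (c * e) := by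
  have hc := hM.nonneg
  obtain ⟨ι, a, v, ha, hac, hM, hS⟩ := hM
  obtain ⟨κ, b, w, hb, hbc, hV, hT⟩ := hV
  have hab : Summable fun p : ι × κ => ‖a p.1 * b p.2‖ := ha.mul_norm hb
  have hsm : ∀ {ι : Type} {a : ι → ℝ} {v : ι → E}, (Summable fun i => ‖a i‖) →
      Summable fun i => ‖a i • U (v i)‖ := by
    intro ι a v ha
    refine Summable.of_nonneg_of_le (fun _ => norm_nonneg _) (fun i => ?_) ha
    rw [norm_smul]
    exact mul_le_of_le_one_right (norm_nonneg _) (hU _)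
  refine ⟨ι × κ, fun p => a p.1 * b p.2, fun p => v p.1 + w p.2, hab, ?_, fun B => ?_, ?_⟩
  · simp only [norm_mul] at hab ⊢
    have h := tsum_mul_tsum_of_summable_norm (f := fun i => ‖a i‖) (g := fun i => ‖b i‖)
      ha.norm hb.norm
    rw [← h]
    exact mul_le_mul hac hbc (tsum_nonneg fun _ => norm_nonneg _) hc
  · by_cases hB : MeasurableSet B
    · have hprod : M.prod V (ContinuousLinearMap.mul ℝ ℝ) =
          atomicMeasure (fun p : ι × κ => a p.1 * b p.2) (fun p => (v p.1, w p.2)) hab := by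
        refine VectorMeasure.prod_eq_of_forall_apply_prod fun s t hs ht => ?_
        refine (hasSum_atomicMeasure _ hab _).unique ?_
        have hp : ∀ p : ι × κ, a p.1 * b p.2 * pointMass (v p.1, w p.2) (s ×ˢ t) =
            (a p.1 * pointMass (v p.1) s) * (b p.2 * pointMass (w p.2) t) := by
          intro p
          rw [pointMass_apply (hs.prod ht), pointMass_apply hs, pointMass_apply ht,
            Set.indicator_prod_one]
          ring
        simp only [hp, ContinuousLinearMap.mul_apply']
        have hs1 := (summable_mul_pointMass ha v s).norm
        have hs2 := (summable_mul_pointMass hb w t).norm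
        have := (summable_mul_of_summable_norm hs1 hs2).hasSum
        rwa [← tsum_mul_tsum_of_summable_norm hs1 hs2, (hM s).tsum_eq, (hV t).tsum_eq] at this
      have h := hasSum_atomicMeasure (fun p : ι × κ => (v p.1, w p.2)) hab
        ((fun z : E × E => z.1 + z.2) ⁻¹' B)
      rw [SymCP.conv, VectorMeasure.map_apply _ measurable_add hB, hprod]
      have hp : ∀ p : ι × κ, pointMass (v p.1 + w p.2) B =
          pointMass (v p.1, w p.2) ((fun z : E × E => z.1 + z.2) ⁻¹' B) := by
        intro p
        rw [pointMass_apply hB, pointMass_apply (measurable_add hB)]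
        rfl
      simp only [hp]
      exact h
    · simp [VectorMeasure.not_measurable _ hB, hasSum_zero]
  · have hs := (summable_mul_of_summable_norm (hsm (v := v) ha) (hsm (v := w) hb)).hasSum
    rw [← tsum_mul_tsum_of_summable_norm (hsm (v := v) ha) (hsm (v := w) hb), hS.tsum_eq,
      hT.tsum_eq] at hs
    simpa only [smul_mul_smul_comm, ← hadd] using hs

theorem IsAtomic.convPow (h0 : U 0 = 1) (hadd : ∀ v w, U (v + w) = U v * U w)
    (hU : ∀ v, ‖U v‖ ≤ 1) (hM : IsAtomic U M S c) (j : ℕ) :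
    IsAtomic U (convPow M j) (S ^ j) (c ^ j) := by
  induction j with
  | zero => simpa [SymCP.convPow] using isAtomic_unitMass h0
  | succ j ih =>
    rw [pow_succ, pow_succ, SymCP.convPow]
    exact ih.conv hadd hU hM

/-- The atoms of all convolution powers form one family indexed by a sigma type, with total mass
controlled by `∑ c^j / j!`. The value of `c'` plays no role later. -/
theorem IsAtomic.expMeasure (h0 : U 0 = 1) (hadd : ∀ v w, U (v + w) = U v * U w)
    (hU : ∀ v, ‖U v‖ ≤ 1) (hM : IsAtomic U M S c) :
    ∃ c', IsAtomic U (expMeasure M) (NormedSpace.exp S) c' := by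
  choose ι a v ha hac hMB hS using fun j => hM.convPow h0 hadd hU j
  have hfib : ∀ j, HasSum (fun i => ‖(j.factorial : ℝ)⁻¹ * a j i‖)
      ((j.factorial : ℝ)⁻¹ * ∑' i, ‖a j i‖) := by
    intro j
    have := (ha j).hasSum.mul_left (j.factorial : ℝ)⁻¹
    simpa only [norm_mul, norm_inv, Real.norm_natCast] using this
  have hs : Summable fun s : (Σ j, ι j) => ‖(s.1.factorial : ℝ)⁻¹ * a s.1 s.2‖ := by
    refine (summable_sigma_of_nonneg fun _ => norm_nonneg _).2 ⟨fun j => (hfib j).summable, ?_⟩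
    simp only [(hfib _).tsum_eq]
    refine Summable.of_nonneg_of_le (fun j => by positivity) (fun j => ?_)
      (hasSum_pow_div_factorial c).summable
    rw [div_eq_inv_mul]
    exact mul_le_mul_of_nonneg_left (hac j) (by positivity)
  refine ⟨_, Σ j, ι j, fun s => (s.1.factorial : ℝ)⁻¹ * a s.1 s.2, fun s => v s.1 s.2, hs, le_rfl,
    fun B => ?_, ?_⟩
  · have h1 := (summable_mul_pointMass hs (fun s : (Σ j, ι j) => v s.1 s.2) B).hasSum
    have h2 := h1.sigma (g := fun j => (j.factorial : ℝ)⁻¹ * SymCP.convPow M j B) fun j => by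
      simpa only [mul_assoc] using (hMB j B).mul_left (j.factorial : ℝ)⁻¹
    have h3 : SymCP.expMeasure M B = ∑' j : ℕ, (j.factorial : ℝ)⁻¹ * SymCP.convPow M j B := rfl
    rw [h3, h2.tsum_eq]
    exact h1
  · have h0s : Summable fun s : (Σ j, ι j) =>
        ((s.1.factorial : ℝ)⁻¹ * a s.1 s.2) • U (v s.1 s.2) := by
      refine Summable.of_norm_bounded hs fun s => ?_
      rw [norm_smul]
      exact mul_le_of_le_one_right (norm_nonneg _) (hU _)
    have h2 := h0s.hasSum.sigma (g := fun j => (j.factorial : ℝ)⁻¹ • S ^ j) fun j => by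
      simpa only [mul_smul] using (hS j).const_smul (j.factorial : ℝ)⁻¹
    rw [(NormedSpace.exp_series_hasSum_exp' (𝕂 := ℝ) S).unique h2]
    exact h0s.hasSum

end AtomicAlgebra

/-! ### Operator norm dominates total variation distance -/

section TotalVariation

variable {E : Type} [AddCommGroup E] [MeasurableSpace E]

/-- The functional `evalSet B` has norm at most `1` and sends each translation to the corresponding
point mass of `B`, hence `T` to `M B`. -/
theorem IsAtomic.abs_apply_le {M : SignedMeasure E} {T : shiftAlgebra E} {c : ℝ}
    (h : IsAtomic shiftElem M T c) (B : Set E) : |M B| ≤ ‖T‖ := by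
  obtain ⟨ι, a, v, -, -, hM, hT⟩ := h
  by_cases hB : MeasurableSet B
  · have h1 := ((evalSet B).mkContinuous 1 (norm_evalSet_le B)).hasSum hT
    have h2 : ∀ i, ((evalSet B).mkContinuous 1 (norm_evalSet_le B)) (a i • shiftElem (v i)) =
        a i * pointMass (v i) B := by
      intro i
      rw [map_smul, LinearMap.mkContinuous_apply, evalSet_shiftElem, pointMass_apply hB, smul_eq_mul]
    simp only [h2] at h1
    rw [(hM B).unique h1, ← Real.norm_eq_abs, LinearMap.mkContinuous_apply, ← one_mul ‖T‖]
    exact norm_evalSet_le B T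
  · rw [VectorMeasure.not_measurable _ hB, abs_zero]
    exact norm_nonneg _

/-- There is a commutative Banach algebra, with a contractive homomorphism from `E`, whose norm
dominates the total variation distance of atomic signed measures. -/
theorem exists_algebra_tvDist_le (E : Type) [AddCommGroup E] [MeasurableSpace E] :
    ∃ (A : Type) (_ : NormedCommRing A) (_ : NormedAlgebra ℝ A) (_ : CompleteSpace A) (U : E → A),
      U 0 = 1 ∧ (∀ v w, U (v + w) = U v * U w) ∧ (∀ v, ‖U v‖ ≤ 1) ∧
        ∀ (M V : SignedMeasure E) (S T : A) (c e : ℝ), IsAtomic U M S c → IsAtomic U V T e →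
          tvDist M V ≤ ENNReal.ofReal ‖S - T‖ :=
  ⟨shiftAlgebra E, inferInstance, inferInstance, inferInstance, shiftElem, shiftElem_zero,
    shiftElem_add, norm_shiftElem_le, fun _ _ _ _ _ _ hM hV => iSup₂_le fun B _ =>
      ENNReal.ofReal_le_ofReal ((hM.sub hV).abs_apply_le B)⟩

end TotalVariation
-- Line mixtures as atomic measures
section LineMixture

variable {d : ℕ}

theorem zsmul_right_injective_of_ne_zero {y : EuclideanSpace ℝ (Fin d)} (hy : y ≠ 0) :
    Function.Injective fun k : ℤ => k • y := by
  intro k l hkl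
  have h : ((k : ℝ) - l) • y = 0 := by
    have hkl' : k • y = l • y := hkl
    rw [sub_smul, Int.cast_smul_eq_zsmul, Int.cast_smul_eq_zsmul, hkl', sub_self]
  have h2 := (smul_eq_zero.1 h).resolve_right hy
  exact_mod_cast sub_eq_zero.1 h2

/-- The complement of the support is null, so `G` lives on the points `k • y`, which are distinct
because `y ≠ 0`. -/
theorem measure_eq_tsum_of_support_subset {G : Measure (EuclideanSpace ℝ (Fin d))}
    {y : EuclideanSpace ℝ (Fin d)} (hy : y ≠ 0)
    (hG : G.support ⊆ {x | ∃ k : ℤ, k ≠ 0 ∧ x = k • y}) (B : Set (EuclideanSpace ℝ (Fin d)))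
    (hB : MeasurableSet B) : G B = ∑' k : ℤ, G (B ∩ {k • y}) := by
  have h1 : G B = G (⋃ k : ℤ, B ∩ {k • y}) := by
    refine measure_congr ?_
    have h0 : G G.supportᶜ = 0 := Measure.measure_compl_support
    filter_upwards [measure_eq_zero_iff_ae_notMem.1 h0] with x hx
    have hx' : x ∈ G.support := by simpa using hx
    obtain ⟨k, -, hk⟩ := hG hx'
    refine propext ⟨fun h => Set.mem_iUnion.2 ⟨k, h, hk⟩, fun h => ?_⟩
    obtain ⟨l, hl⟩ := Set.mem_iUnion.1 h
    exact hl.1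
  rw [h1, measure_iUnion]
  · intro k l hkl
    refine Set.disjoint_left.2 fun x hx hx' => hkl ?_
    exact zsmul_right_injective_of_ne_zero hy (hx.2.symm.trans hx'.2)
  · exact fun k => hB.inter (measurableSet_singleton _)

theorem hasSum_measureReal_of_support_subset {G : Measure (EuclideanSpace ℝ (Fin d))}
    [IsProbabilityMeasure G] {y : EuclideanSpace ℝ (Fin d)} (hy : y ≠ 0)
    (hG : G.support ⊆ {x | ∃ k : ℤ, k ≠ 0 ∧ x = k • y}) {B : Set (EuclideanSpace ℝ (Fin d))}
    (hB : MeasurableSet B) :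
    HasSum (fun k : ℤ => G.real {k • y} * pointMass (k • y) B) (G.real B) := by
  have h := measure_eq_tsum_of_support_subset hy hG B hB
  have hne : ∑' k : ℤ, G (B ∩ {k • y}) ≠ ⊤ := h ▸ measure_ne_top G B
  have h2 := ENNReal.hasSum_toReal hne
  rw [← ENNReal.tsum_toReal_eq fun k => measure_ne_top G _, ← h] at h2
  have h3 : ∀ k : ℤ, G.real {k • y} * pointMass (k • y) B = (G (B ∩ {k • y})).toReal := by
    intro k
    rw [pointMass_apply hB]
    by_cases hk : k • y ∈ B
    · rw [Set.indicator_of_mem hk, Pi.one_apply, mul_one,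
        Set.inter_eq_self_of_subset_right (Set.singleton_subset_iff.2 hk)]
      rfl
    · rw [Set.indicator_of_notMem hk, mul_zero, Set.inter_singleton_eq_empty.2 hk, measure_empty,
        ENNReal.toReal_zero]
  simp only [h3]
  exact h2

theorem isSymmetricLaw_of_lineSigma_ne_top {G : Measure (EuclideanSpace ℝ (Fin d))}
    [IsProbabilityMeasure G] {y : EuclideanSpace ℝ (Fin d)} (hy : y ≠ 0)
    (hG : G.support ⊆ {x | ∃ k : ℤ, k ≠ 0 ∧ x = k • y})
    (hsymm : ∀ k : ℕ, 1 ≤ k → G {(k : ℤ) • y} = G {(-(k : ℤ)) • y}) (hσ : lineSigma G y ≠ ⊤) :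
    IsSymmetricLaw (fun k : ℤ => G.real {k • y}) (lineSigma G y).toReal where
  nonneg k := measureReal_nonneg
  hasSum_one := by
    have h := hasSum_measureReal_of_support_subset hy hG MeasurableSet.univ
    simpa [pointMass_apply MeasurableSet.univ] using h
  symm k := by
    obtain ⟨n, rfl | rfl⟩ := k.eq_nat_or_neg
    · rcases Nat.eq_zero_or_pos n with rfl | hn
      · simp
      · simp only [Measure.real, hsymm n hn]
    · rcases Nat.eq_zero_or_pos n with rfl | hn
      · simp
      · simp only [Measure.real, neg_neg, hsymm n hn]
  zero := by
    have h0 : G G.supportᶜ = 0 := Measure.measure_compl_support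
    have h : G {(0 : ℤ) • y} = 0 := by
      refine measure_mono_null (Set.singleton_subset_iff.2 fun hx => ?_) h0
      obtain ⟨k, hk, hk'⟩ := hG hx
      exact hk (zsmul_right_injective_of_ne_zero hy hk').symm
    simp only [Measure.real, h, ENNReal.toReal_zero]
  sigma_nonneg := ENNReal.toReal_nonneg
  hasSum_sq := by
    set W := ∑' k : ℤ, ENNReal.ofReal ((k : ℝ) ^ 2) * G {k • y} with hW
    have hL : lineSigma G y = W ^ (1 / 2 : ℝ) := rfl
    have hWt : W ≠ ⊤ := by
      intro h
      rw [hL, h, ENNReal.top_rpow_of_pos (by norm_num)] at hσ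
      exact hσ rfl
    have hsq : (lineSigma G y).toReal ^ 2 = W.toReal := by
      rw [← ENNReal.toReal_pow, hL, ← ENNReal.rpow_natCast, ← ENNReal.rpow_mul]
      norm_num
    have h2 := ENNReal.hasSum_toReal (hW ▸ hWt)
    rw [← ENNReal.tsum_toReal_eq fun k => ENNReal.mul_ne_top ENNReal.ofReal_ne_top
      (measure_ne_top G _), ← hW] at h2
    rw [hsq]
    simpa only [ENNReal.toReal_mul, ENNReal.toReal_ofReal (sq_nonneg _), Measure.real] using h2

variable {K : ℕ} {F : Measure (EuclideanSpace ℝ (Fin d))} {q : ℝ} {p : Fin K → ℝ}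
  {Fm : Fin K → Measure (EuclideanSpace ℝ (Fin d))} {y : Fin K → EuclideanSpace ℝ (Fin d)}

/-- An empty mixture would force `q = 1`. At least one component is needed for `1 ≤ S`, hence for `1
≤ D`. -/
theorem IsLineMixture.nonempty (h : IsLineMixture F q p Fm y) : Nonempty (Fin K) := by
  by_contra hK
  rw [not_nonempty_iff] at hK
  have := h.sum_p
  rw [Finset.univ_eq_empty, Finset.sum_empty] at this
  linarith [h.q_mem.2]

theorem IsLineMixture.real_apply (h : IsLineMixture F q p Fm y)
    {B : Set (EuclideanSpace ℝ (Fin d))} (hB : MeasurableSet B) :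
    F.real B = q * pointMass 0 B + ∑ m, p m * (Fm m).real B := by
  have := h.isProb
  have h1 : F B = ENNReal.ofReal q * Measure.dirac 0 B + ∑ m, ENNReal.ofReal (p m) * Fm m B := by
    rw [h.eq_mixture]
    simp
  have h2 : (Measure.dirac (0 : EuclideanSpace ℝ (Fin d)) B).toReal = pointMass 0 B := by
    rw [Measure.dirac_apply' _ hB, pointMass_apply hB]
    by_cases h0 : (0 : EuclideanSpace ℝ (Fin d)) ∈ B <;> simp [h0]
  have hne : ∀ m, ENNReal.ofReal (p m) * Fm m B ≠ ⊤ := fun m =>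
    ENNReal.mul_ne_top ENNReal.ofReal_ne_top (measure_ne_top _ _)
  rw [Measure.real, h1, ENNReal.toReal_add (ENNReal.mul_ne_top ENNReal.ofReal_ne_top
    (measure_ne_top _ _)) (ENNReal.sum_ne_top.2 fun m _ => hne m),
    ENNReal.toReal_sum fun m _ => hne m, ENNReal.toReal_mul, h2,
    ENNReal.toReal_ofReal h.q_mem.1.le]
  simp only [ENNReal.toReal_mul, ENNReal.toReal_ofReal (h.p_mem _).1.le, Measure.real]

theorem IsLineMixture.exists_isAtomic [IsProbabilityMeasure F] {A : Type*}
    [NormedCommRing A] [NormedAlgebra ℝ A] {U : EuclideanSpace ℝ (Fin d) → A} (h0 : U 0 = 1)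
    (h : IsLineMixture F q p Fm y)
    {T : Fin K → A}
    (hT : ∀ m, HasSum (fun k : ℤ => (Fm m).real {k • y m} • U (k • y m)) (T m)) :
    ∃ c, IsAtomic U F.toSignedMeasure (q • 1 + ∑ m, p m • T m) c := by
  have := h.isProb
  have hs : ∀ m, Summable fun k : ℤ => ‖(Fm m).real {k • y m}‖ := by
    intro m
    have h1 := (hasSum_measureReal_of_support_subset (h.y_ne_zero m) (h.support_subset m)
      MeasurableSet.univ).summable.norm
    simpa [pointMass_apply MeasurableSet.univ] using h1
  have hA : ∀ m, IsAtomic U (atomicMeasure (fun k : ℤ => (Fm m).real {k • y m})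
      (fun k => k • y m) (hs m)) (T m) (∑' k : ℤ, ‖(Fm m).real {k • y m}‖) := fun m =>
    ⟨ℤ, _, _, hs m, le_rfl, hasSum_atomicMeasure _ (hs m), hT m⟩
  have hF : F.toSignedMeasure = q • unitMass (EuclideanSpace ℝ (Fin d)) +
      ∑ m, p m • atomicMeasure (fun k : ℤ => (Fm m).real {k • y m}) (fun k => k • y m) (hs m) := by
    ext B hB
    have hm : ∀ m, atomicMeasure (fun k : ℤ => (Fm m).real {k • y m}) (fun k => k • y m) (hs m) B =
        (Fm m).real B := fun m =>
      (hasSum_atomicMeasure _ (hs m) B).unique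
        (hasSum_measureReal_of_support_subset (h.y_ne_zero m) (h.support_subset m) hB)
    rw [Measure.toSignedMeasure_apply_measurable hB, h.real_apply hB]
    simp [hm, unitMass, pointMass]
  rw [hF]
  exact ⟨_, ((isAtomic_unitMass h0).smul q).add
    (isAtomic_sum Finset.univ fun m => (hA m).smul (p m))⟩

theorem IsLineMixture.tvDist_le [IsProbabilityMeasure F] (h : IsLineMixture F q p Fm y)
    (hσ : ∀ m, lineSigma (Fm m) (y m) ≠ ⊤) {n : ℕ} (hn : 1 ≤ n) :
    tvDist (convPow F.toSignedMeasure n)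
      (conv (expMeasure ((n : ℝ) • (F.toSignedMeasure - unitMass (EuclideanSpace ℝ (Fin d)))))
        (unitMass (EuclideanSpace ℝ (Fin d)) - ((n : ℝ) / 2) • convPow
          (F.toSignedMeasure - unitMass (EuclideanSpace ℝ (Fin d))) 2)) ≤
      ENNReal.ofReal (5000000 * 162 ^ 4 / ((n : ℝ) ^ 2 * q ^ (13 / 2 : ℝ)) *
        (∑ m, √(1 + (lineSigma (Fm m) (y m)).toReal)) ^ 4) := by
  have := h.isProb
  have := h.nonempty
  have hlaw := fun m => isSymmetricLaw_of_lineSigma_ne_top (h.y_ne_zero m) (h.support_subset m)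
    (h.symm m) (hσ m)
  obtain ⟨A, _, _, _, U, h0, hadd, hU, htv⟩ :=
    exists_algebra_tvDist_le (EuclideanSpace ℝ (Fin d))
  have hUm : ∀ m, IsContractiveHom fun k : ℤ => U (k • y m) := fun m =>
    ⟨by rw [zero_smul, h0], fun i j => by rw [add_smul, hadd], fun k => hU _⟩
  have hTs : ∀ m, ∃ T : A, HasSum (fun k : ℤ => (Fm m).real {k • y m} • U (k • y m)) T := by
    intro m
    refine Summable.of_norm_bounded (hlaw m).hasSum_one.summable.norm fun k => ?_
    rw [norm_smul]
    exact mul_le_of_le_one_right (norm_nonneg _) (hU _)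
  choose T hT using hTs
  obtain ⟨c, hF⟩ := h.exists_isAtomic h0 hT
  have hI := isAtomic_unitMass h0
  have hD := hF.sub hI
  obtain ⟨c', hexp⟩ := (hD.smul (n : ℝ)).expMeasure h0 hadd hU
  have hV := hI.sub ((hD.convPow h0 hadd hU 2).smul ((n : ℝ) / 2))
  refine (htv _ _ _ _ _ _ (hF.convPow h0 hadd hU n) (hexp.conv hadd hU hV)).trans ?_
  refine ENNReal.ofReal_le_ofReal ?_
  exact norm_mixture_pow_sub_exp_mul_le (h0 ▸ hU 0) hUm hlaw hT h.q_mem (fun m => (h.p_mem m).1)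
    h.sum_p rfl hn

end LineMixture
end SymCP

theorem theorem10 :
    ∃ C : ℝ, 0 < C ∧
      ∀ (d K : ℕ) (F : Measure (EuclideanSpace ℝ (Fin d))) [IsProbabilityMeasure F]
        (q : ℝ) (p : Fin K → ℝ) (Fm : Fin K → Measure (EuclideanSpace ℝ (Fin d)))
        (y : Fin K → EuclideanSpace ℝ (Fin d)),
        SymCP.IsLineMixture F q p Fm y →
        ∀ n : ℕ, 1 ≤ n →
          SymCP.tvDist
              (SymCP.convPow F.toSignedMeasure n)
              (SymCP.conv
                (SymCP.expMeasure
                  ((n : ℝ) • (F.toSignedMeasure - SymCP.unitMass (EuclideanSpace ℝ (Fin d)))))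
                (SymCP.unitMass (EuclideanSpace ℝ (Fin d))
                  - ((n : ℝ) / 2) • SymCP.convPow
                      (F.toSignedMeasure - SymCP.unitMass (EuclideanSpace ℝ (Fin d))) 2))
            ≤ ENNReal.ofReal (C / ((n : ℝ) ^ 2 * q ^ (13 / 2 : ℝ)))
                * (∑ m, (1 + SymCP.lineSigma (Fm m) (y m)) ^ (1 / 2 : ℝ)) ^ 4 := by
  refine ⟨5000000 * 162 ^ 4, by norm_num, fun d K F _ q p Fm y h n hn => ?_⟩
  have hn0 : (0 : ℝ) < n := by exact_mod_cast hn
  have hpos : 0 < 5000000 * 162 ^ 4 / ((n : ℝ) ^ 2 * q ^ (13 / 2 : ℝ)) := by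
    have := Real.rpow_pos_of_pos h.q_mem.1 (13 / 2)
    positivity
  by_cases hσ : ∀ m, SymCP.lineSigma (Fm m) (y m) ≠ ⊤
  · refine (h.tvDist_le hσ hn).trans_eq ?_
    have hm : ∀ m, (1 + SymCP.lineSigma (Fm m) (y m)) ^ (1 / 2 : ℝ) =
        ENNReal.ofReal √(1 + (SymCP.lineSigma (Fm m) (y m)).toReal) := by
      intro m
      rw [Real.sqrt_eq_rpow, ← ENNReal.ofReal_rpow_of_nonneg
        (add_nonneg zero_le_one ENNReal.toReal_nonneg) (by norm_num),
        ENNReal.ofReal_add zero_le_one ENNReal.toReal_nonneg, ENNReal.ofReal_one,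
        ENNReal.ofReal_toReal (hσ m)]
    simp only [hm]
    rw [ENNReal.ofReal_mul hpos.le, ← ENNReal.ofReal_sum_of_nonneg fun m _ => Real.sqrt_nonneg _,
      ENNReal.ofReal_pow (Finset.sum_nonneg fun m _ => Real.sqrt_nonneg _)]
  -- If some `σ_m` is infinite, the right side is `∞`, because its real prefactor is strictly
  -- positive.
  · push Not at hσ
    obtain ⟨m, hm⟩ := hσ
    have htop : ∑ m, (1 + SymCP.lineSigma (Fm m) (y m)) ^ (1 / 2 : ℝ) = ⊤ := by
      refine ENNReal.sum_eq_top.2 ⟨m, Finset.mem_univ m, ?_⟩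
      rw [hm, add_top, ENNReal.top_rpow_of_pos (by norm_num)]
    rw [htop, ENNReal.top_pow (by norm_num), ENNReal.mul_top (ENNReal.ofReal_pos.2 hpos).ne']
    exact le_top
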